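/- Let $Q$ be a probability distribution on $\mathbb{R}$ with expectation $0$, variance $1$ and finite fourth moment $b$. For $n \ge m \ge 0$ let $X(n,m)$ be a real random $n\times m$ matrix with i.i.d. entries of distribution $Q$, and let $$f(n,m;\mu,\nu) := \mathbb{E}\big(\det(X(n,m)^TX(n,m)-\mu)\,\det(X(n,m)^TX(n,m)-\nu)\big)$$ be the second-order correlation function of the characteristic polynomial of the unrescaled real sample covariance matrix (the determinant of the $0\times 0$ matrix is $1$; the product of determinants is integrable). For $\xi\in(0,4)$ let $g(\xi) := \frac{1}{2\pi\xi}\sqrt{\xi(4-\xi)}$ be the Marčenko–Pastur density. For any integer $\alpha\ge 0$, $\xi\in(0,4)$ and $\mu,\nu\in\mathbb{R}$, set $$Z_N(\xi,\mu,\nu) := \big(N^2\xi^2+N\xi(\mu+\nu)+\mu\nu\big)^{\alpha/2}\exp\big(-N\xi-\tfrac12(\mu+\nu)\big).$$ Then, with $n=N$ and $m=N-\alpha$ (for $N \ge \alpha$), $$\lim_{N\to\infty}\left(N^{-1}\,\xi^{-1}\,g(\xi)^{-3}\,Z_N\big(\xi,\tfrac{\mu}{g(\xi)},\tfrac{\nu}{g(\xi)}\big)\cdot\frac{f\big(n,m;N\xi+\tfrac{\mu}{g(\xi)},N\xi+\tfrac{\nu}{g(\xi)}\big)}{n!\,m!}\right)=\exp(b-3)\,\widetilde{\mathbb{S}}(\mu,\nu),$$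 where $\widetilde{\mathbb{S}}$ is the "differentiated" sine kernel $$\widetilde{\mathbb{S}}(x,y) := \frac{2\sin\pi(x-y)}{\pi(x-y)^3}-\frac{2\cos\pi(x-y)}{(x-y)^2}\quad(x\ne y),\qquad \widetilde{\mathbb{S}}(x,x):=\frac{2\pi^2}{3}$$ (the value on the diagonal being the continuous extension). -/

import Mathlib

open MeasureTheory ProbabilityTheory Filter Topology
open scoped Matrix Nat

noncomputable section

/-- The density of the Marčenko-Pastur distribution on `(0, 4)`. -/
def mpDensity (ξ : ℝ) : ℝ := 1 / (2 * Real.pi * ξ) * √(ξ * (4 - ξ))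

/-- The "differentiated" sine kernel; on the diagonal, where the formula reads `∞ - ∞`, it is
extended by continuity: with `d = x - y`,
`2 sin (π d) / (π d ^ 3) - 2 cos (π d) / d ^ 2` tends to `2 π ^ 2 / 3` as `d` tends to `0`. -/
def diffSineKernel (x y : ℝ) : ℝ :=
  if x = y then 2 * Real.pi ^ 2 / 3
  else 2 * Real.sin (Real.pi * (x - y)) / (Real.pi * (x - y) ^ 3)
    - 2 * Real.cos (Real.pi * (x - y)) / (x - y) ^ 2

/-- The standing moment conditions on the entry distribution `Q` (a probability measure on `ℝ`):
expectation `0`, variance `1`, finite fourth moment `b`. -/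
structure HasStandingMoments (Q : Measure ℝ) (b : ℝ) : Prop where
  memLp : MemLp id 4 Q
  mean_eq : ∫ x, x ∂Q = 0
  variance_eq : Var[id; Q] = 1
  fourth_eq : ∫ x, x ^ 4 ∂Q = b

/-- The random `n × m` matrix `X` has i.i.d. entries with distribution `Q`. -/
structure IsIIDMatrix {Ω : Type*} [MeasurableSpace Ω] {n m : ℕ}
    (X : Ω → Matrix (Fin n) (Fin m) ℝ) (Q : Measure ℝ) (P : Measure Ω) : Prop where
  hasLaw : ∀ i j, HasLaw (fun ω => X ω i j) Q P
  indep : iIndepFun (fun (p : Fin n × Fin m) ω => X ω p.1 p.2) P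

/-- `det (Xᵀ X - μ) * det (Xᵀ X - ν)` -/
def charPolyProduct {n m : ℕ} (X : Matrix (Fin n) (Fin m) ℝ) (μ ν : ℝ) : ℝ :=
  (Xᵀ * X - μ • (1 : Matrix (Fin m) (Fin m) ℝ)).det *
    (Xᵀ * X - ν • (1 : Matrix (Fin m) (Fin m) ℝ)).det

/-- The second-order correlation function `f (n, m; μ, ν)` of the characteristic polynomial of
the unrescaled real sample covariance matrix `Xᵀ X`. -/
def secondCorrelation {Ω : Type*} [MeasurableSpace Ω] {n m : ℕ}
    (X : Ω → Matrix (Fin n) (Fin m) ℝ) (P : Measure Ω) (μ ν : ℝ) : ℝ :=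
  ∫ ω, charPolyProduct (X ω) μ ν ∂P

/-- The scaling factor `Z_N (ξ, μ, ν)`. -/
def bulkScaling (α N : ℕ) (ξ μ ν : ℝ) : ℝ :=
  ((N : ℝ) ^ 2 * ξ ^ 2 + N * ξ * (μ + ν) + μ * ν) ^ ((α : ℝ) / 2)
    * Real.exp (-(N * ξ) - (μ + ν) / 2)

end

/-! ### Rank-one updates, derivatives and resolvent identities for determinants -/

section Determinants

variable {m : Type*} [Fintype m] [DecidableEq m]

/-! The numbers f(n, m; s, t) / (n! m!) have an explicit exponential generating function, and the
limit is an asymptotic analysis of its Cauchy coefficient integral.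

Generating function. Adding a row r to X changes XᵀX by the rank-one matrix r rᵀ, so det(XᵀX - s)
becomes affine in a quadratic form in r with the adjugate as coefficient matrix. Averaging the
product of two such forms over r uses only moments up to order four and yields three terms: the
product of the means, twice the trace of the product of adjugates, and (b - 3) times a sum over
diagonal entries. Jacobi's formula turns the traces into derivatives in s and t, the resolvent
identity does the same for the trace of the product, and the diagonal entries are determinants for X
with a column removed. The result is a recursion (`gramCorr_succ_succ`), equivalent to a
differential equation in x solved by `genFun` with c = b - 3. Since xy → 1 in the limit, c
contributes only the factor exp(b - 3). `gramCorr_eq_torusCoeff` states this as a Cauchy integral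
over a torus.

Asymptotics. With q = √(st), the torus is parametrised by x = q w e^{iτ/N} and y = w e^{-iτ/N} / q,
where w = exp(-(1 + iy)/(2N)) for a new real variable y. Then 1 - xy = 1 - w² is of order 1/N, the
pole of order three supplies the scale, and the factor exp(-(s + t)/2) in Z_N compensates the
growth. A uniform integrable majorant (`norm_bulkIntegrand_le`) gives dominated convergence to the
integral of `bulkLimit`.

Evaluation. With ζ = 1 + iy, the Gaussian τ-integral followed by a Gaussian Fourier representation
leaves ζ⁻² times an exponential linear in ζ. Its inverse Laplace transform is the positive part of 1
- ξ/4 - v². The Fourier transform of this truncated parabola is the differentiated sine kernel, and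
the powers of g(ξ) normalise width and frequency. -/

lemma Matrix.eventually_det_add_smul_one_ne_zero (A : Matrix m m ℝ) :
    ∀ᶠ x : ℝ in 𝓝[≠] 0, (A + x • (1 : Matrix m m ℝ)).det ≠ 0 := by
  have h0 : (-A).charpoly ≠ 0 := (Matrix.charpoly_monic _).ne_zero
  have hfin : ((-A).charpoly.roots.toFinset : Set ℝ).Finite := Finset.finite_toSet _
  have h1 : ∀ᶠ x : ℝ in 𝓝[≠] 0, x ∉ ((-A).charpoly.roots.toFinset : Set ℝ) := by
    have hcl := (hfin.subset (Set.sdiff_subset (t := {(0 : ℝ)}))).isClosed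
    -- The point 0 is taken out because it is itself a root when A is singular.
    have : ∀ᶠ x : ℝ in 𝓝 0, x ∉ ((-A).charpoly.roots.toFinset : Set ℝ) \ {0} :=
      hcl.isOpen_compl.mem_nhds (by simp)
    filter_upwards [this.filter_mono nhdsWithin_le_nhds, self_mem_nhdsWithin] with x hx hx0 hmem
    exact hx ⟨hmem, hx0⟩
  filter_upwards [h1] with x hx hdet
  apply hx
  simp only [Finset.mem_coe, Multiset.mem_toFinset, Polynomial.mem_roots h0, Polynomial.IsRoot.def,
    Matrix.eval_charpoly]
  rw [← hdet]
  congr 1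
  ext i j
  simp [Matrix.scalar_apply, Matrix.diagonal_apply, Matrix.one_apply]
  ring

/-- The matrix determinant lemma, without an invertibility hypothesis. -/
lemma Matrix.det_add_vecMulVec (A : Matrix m m ℝ) (u v : m → ℝ) :
    (A + Matrix.vecMulVec u v).det = A.det + v ⬝ᵥ (A.adjugate *ᵥ u) := by
  have key : ∀ B : Matrix m m ℝ, B.det ≠ 0 →
      (B + Matrix.vecMulVec u v).det = B.det + v ⬝ᵥ (B.adjugate *ᵥ u) := by
    intro B hB
    have h := Matrix.det_add_replicateCol_mul_replicateRow (ι := Unit)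
      (isUnit_iff_ne_zero.2 hB) u v
    rw [← Matrix.vecMulVec_eq] at h
    rw [h, Matrix.det_unique (n := Unit), Matrix.add_apply, Matrix.one_apply_eq, mul_add, mul_one,
      Matrix.mul_assoc, ← Matrix.replicateCol_mulVec, Matrix.replicateRow_mul_replicateCol_apply,
      Matrix.inv_def, Matrix.smul_mulVec, dotProduct_smul, Ring.inverse_eq_inv', smul_eq_mul,
      mul_inv_cancel_left₀ hB]
  have hc1 : Continuous fun x : ℝ => (A + x • (1 : Matrix m m ℝ) + Matrix.vecMulVec u v).det := by
    fun_prop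
  have hc2 : Continuous fun x : ℝ => (A + x • (1 : Matrix m m ℝ)).det +
      v ⬝ᵥ ((A + x • (1 : Matrix m m ℝ)).adjugate *ᵥ u) := by
    fun_prop
  have ht1 := (hc1.tendsto 0).mono_left (nhdsWithin_le_nhds (s := {0}ᶜ))
  have ht2 := (hc2.tendsto 0).mono_left (nhdsWithin_le_nhds (s := {0}ᶜ))
  -- Both sides are continuous in the shift x and agree for small x ≠ 0, where A + x is invertible,
  -- hence also at x = 0.
  have := tendsto_nhds_unique (ht1.congr' ?_) ht2
  · simpa using this
  · filter_upwards [Matrix.eventually_det_add_smul_one_ne_zero A] with x hx using key _ hx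

/-- Jacobi's formula, read off from the Leibniz expansion: differentiating the factor of row i
replaces that row by -eᵢ, which leaves minus the i-th diagonal entry of the adjugate. -/
lemma Matrix.hasDerivAt_det_sub_smul_one (A : Matrix m m ℝ) (s : ℝ) :
    HasDerivAt (fun s : ℝ => (A - s • (1 : Matrix m m ℝ)).det)
      (-(A - s • (1 : Matrix m m ℝ)).adjugate.trace) s := by
  have h1 : ∀ s : ℝ, (A - s • (1 : Matrix m m ℝ)).det =
      ∑ σ : Equiv.Perm m, (Equiv.Perm.sign σ : ℝ) *
        ∏ i, (A - s • (1 : Matrix m m ℝ)) i (σ i) := by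
    intro s
    rw [← Matrix.det_transpose, Matrix.det_apply']
    simp
  simp_rw [h1]
  have h2 : ∀ σ : Equiv.Perm m, HasDerivAt
      (fun s : ℝ => (Equiv.Perm.sign σ : ℝ) * ∏ i, (A - s • (1 : Matrix m m ℝ)) i (σ i))
      ((Equiv.Perm.sign σ : ℝ) * ∑ i, (∏ j ∈ Finset.univ.erase i,
        (A - s • (1 : Matrix m m ℝ)) j (σ j)) * (-(1 : Matrix m m ℝ) i (σ i))) s := by
    intro σ
    refine HasDerivAt.const_mul _ ?_
    have h3 := HasDerivAt.fun_finsetProd (u := (Finset.univ : Finset m))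
      (f := fun i (s : ℝ) => (A - s • (1 : Matrix m m ℝ)) i (σ i))
      (f' := fun i => -(1 : Matrix m m ℝ) i (σ i)) (x := s) ?_
    · simpa [smul_eq_mul] using h3
    · intro i _
      simpa using ((hasDerivAt_id s).mul_const ((1 : Matrix m m ℝ) i (σ i))).const_sub (A i (σ i))
  refine (HasDerivAt.fun_sum fun σ _ => h2 σ).congr_deriv ?_
  rw [Matrix.trace, ← Finset.sum_neg_distrib]
  simp_rw [Finset.mul_sum]
  rw [Finset.sum_comm]
  refine Finset.sum_congr rfl fun i _ => ?_
  rw [Matrix.diag_apply, Matrix.adjugate_apply, ← Matrix.det_transpose, Matrix.det_apply',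
    ← Finset.sum_neg_distrib]
  refine Finset.sum_congr rfl fun σ _ => ?_
  rw [← Finset.mul_prod_erase Finset.univ _ (Finset.mem_univ i)]
  simp only [Matrix.transpose_apply, Matrix.updateRow_self]
  have h4 : ∏ j ∈ Finset.univ.erase i,
      (A - s • (1 : Matrix m m ℝ)).updateRow i (Pi.single i 1) j (σ j) =
      ∏ j ∈ Finset.univ.erase i, (A - s • (1 : Matrix m m ℝ)) j (σ j) :=
    Finset.prod_congr rfl fun j hj => by rw [Matrix.updateRow_ne (Finset.ne_of_mem_erase hj)]
  rw [h4]
  simp only [Matrix.one_apply, Pi.single_apply, eq_comm]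
  ring

/-- The resolvent identity for adjugates. -/
lemma Matrix.sub_mul_trace_adjugate_mul_adjugate (A : Matrix m m ℝ) (s t : ℝ) :
    (s - t) * ((A - s • (1 : Matrix m m ℝ)).adjugate * (A - t • (1 : Matrix m m ℝ)).adjugate).trace
      = (A - s • (1 : Matrix m m ℝ)).adjugate.trace * (A - t • (1 : Matrix m m ℝ)).det
        - (A - s • (1 : Matrix m m ℝ)).det * (A - t • (1 : Matrix m m ℝ)).adjugate.trace := by
  set B := A - s • (1 : Matrix m m ℝ)
  set C := A - t • (1 : Matrix m m ℝ)
  have h : (s - t) • (1 : Matrix m m ℝ) = C - B := by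
    simp only [B, C, sub_smul]; abel
  have h2 : (s - t) • (B.adjugate * C.adjugate) =
      C.det • B.adjugate - B.det • C.adjugate := by
    calc (s - t) • (B.adjugate * C.adjugate)
        = B.adjugate * ((s - t) • (1 : Matrix m m ℝ)) * C.adjugate := by simp
      _ = B.adjugate * (C * C.adjugate) - (B.adjugate * B) * C.adjugate := by
          rw [h]; noncomm_ring
      _ = _ := by rw [Matrix.mul_adjugate, Matrix.adjugate_mul]; simp
  rw [← smul_eq_mul, ← Matrix.trace_smul, h2]
  simp [mul_comm]

end Determinants

/-! ### A polynomial bound, of degree two in each entry -/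

section Bound

/-- The dominating function for the characteristic polynomial of `Xᵀ X`. -/
def entryBound {n m : ℕ} (X : Fin n → Fin m → ℝ) : ℝ := ∏ i, ∏ j, (1 + |X i j|) ^ 2

lemma entryBound_pos {n m : ℕ} (X : Fin n → Fin m → ℝ) : 0 < entryBound X :=
  Finset.prod_pos fun _ _ => Finset.prod_pos fun _ _ => by positivity

/-- The characteristic polynomial `det (Xᵀ X - s)`. -/
def gramDet {n m : ℕ} (X : Fin n → Fin m → ℝ) (s : ℝ) : ℝ :=
  ((Matrix.of X)ᵀ * Matrix.of X - s • (1 : Matrix (Fin m) (Fin m) ℝ)).det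

/-- The derivative of `gramDet` in the spectral parameter. -/
def gramDet' {n m : ℕ} (X : Fin n → Fin m → ℝ) (s : ℝ) : ℝ :=
  -((Matrix.of X)ᵀ * Matrix.of X - s • (1 : Matrix (Fin m) (Fin m) ℝ)).adjugate.trace

lemma hasDerivAt_gramDet {n m : ℕ} (X : Fin n → Fin m → ℝ) (s : ℝ) :
    HasDerivAt (gramDet X) (gramDet' X s) s :=
  Matrix.hasDerivAt_det_sub_smul_one _ s

lemma continuous_gramDet {n m : ℕ} (s : ℝ) :
    Continuous fun X : Fin n → Fin m → ℝ => gramDet X s := by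
  unfold gramDet
  have : Continuous fun X : Fin n → Fin m → ℝ => Matrix.of X := continuous_id
  fun_prop

lemma continuous_gramDet' {n m : ℕ} (s : ℝ) :
    Continuous fun X : Fin n → Fin m → ℝ => gramDet' X s := by
  unfold gramDet'
  have : Continuous fun X : Fin n → Fin m → ℝ => Matrix.of X := continuous_id
  fun_prop

/-- By the Schur complement the determinant is that of the block matrix with rows (1, X) and (-Xᵀ,
-s). In its Leibniz expansion each of the n + m columns contributes a single factor, bounded by a
row product of X for the first n columns and by (1 + |s|) times a column product for the others.
Each entry is thus used twice, so a product of two determinants has degree four per entry, as the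
fourth moment allows. -/
lemma abs_gramDet_le {n m : ℕ} (X : Fin n → Fin m → ℝ) (s : ℝ) :
    |gramDet X s| ≤ (n + m)! * (1 + |s|) ^ m * entryBound X := by
  have h1 : gramDet X s = (Matrix.fromBlocks (1 : Matrix (Fin n) (Fin n) ℝ) (Matrix.of X)
      (-(Matrix.of X)ᵀ) (-s • (1 : Matrix (Fin m) (Fin m) ℝ))).det := by
    rw [Matrix.det_fromBlocks_one₁₁, gramDet]
    congr 1
    rw [Matrix.neg_mul, neg_smul]
    abel
  have hone : ∀ i j, 1 ≤ 1 + |X i j| := fun i j => by linarith [abs_nonneg (X i j)]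
  have hle : ∀ i j, |X i j| ≤ 1 + |X i j| := fun i j => by linarith
  have hrow : ∀ i j, 1 + |X i j| ≤ ∏ j, (1 + |X i j|) := fun i j =>
    (le_mul_of_one_le_right (zero_le_one.trans (hone i j)) (Finset.one_le_prod fun k _ => hone i k)).trans_eq
      (Finset.mul_prod_erase Finset.univ (fun j => 1 + |X i j|) (Finset.mem_univ j))
  have hcol : ∀ i j, 1 + |X i j| ≤ ∏ i, (1 + |X i j|) := fun i j =>
    (le_mul_of_one_le_right (zero_le_one.trans (hone i j)) (Finset.one_le_prod fun k _ => hone k j)).trans_eq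
      (Finset.mul_prod_erase Finset.univ (fun i => 1 + |X i j|) (Finset.mem_univ i))
  have hrow1 : ∀ i, 1 ≤ ∏ j, (1 + |X i j|) := fun i => Finset.one_le_prod fun k _ => hone i k
  have hcol1 : ∀ j, 1 ≤ ∏ i, (1 + |X i j|) := fun j => Finset.one_le_prod fun k _ => hone k j
  have hs : 0 ≤ |s| := abs_nonneg s
  rw [h1, Matrix.det_apply]
  refine (Finset.abs_sum_le_sum_abs _ _).trans ?_
  have hterm : ∀ σ : Equiv.Perm (Fin n ⊕ Fin m),
      |Equiv.Perm.sign σ • ∏ k, Matrix.fromBlocks (1 : Matrix (Fin n) (Fin n) ℝ) (Matrix.of X)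
        (-(Matrix.of X)ᵀ) (-s • (1 : Matrix (Fin m) (Fin m) ℝ)) (σ k) k| ≤
      (1 + |s|) ^ m * entryBound X := by
    intro σ
    rw [Units.smul_def, zsmul_eq_mul, abs_mul, Finset.abs_prod]
    have hsign : |(((Equiv.Perm.sign σ : ℤˣ) : ℤ) : ℝ)| = 1 := by
      rcases Int.units_eq_one_or (Equiv.Perm.sign σ) with h | h <;> simp [h]
    rw [hsign, one_mul, Fintype.prod_sum_type]
    have hA : ∀ i : Fin n, |Matrix.fromBlocks (1 : Matrix (Fin n) (Fin n) ℝ) (Matrix.of X)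
        (-(Matrix.of X)ᵀ) (-s • (1 : Matrix (Fin m) (Fin m) ℝ)) (σ (Sum.inl i)) (Sum.inl i)| ≤
        ∏ j, (1 + |X i j|) := by
      intro i
      rcases σ (Sum.inl i) with k | k
      · simp only [Matrix.fromBlocks_apply₁₁, Matrix.one_apply]
        split_ifs
        · simpa using hrow1 i
        · simpa using zero_le_one.trans (hrow1 i)
      · simpa using (hle i k).trans (hrow i k)
    have hB : ∀ j : Fin m, |Matrix.fromBlocks (1 : Matrix (Fin n) (Fin n) ℝ) (Matrix.of X)
        (-(Matrix.of X)ᵀ) (-s • (1 : Matrix (Fin m) (Fin m) ℝ)) (σ (Sum.inr j)) (Sum.inr j)| ≤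
        (1 + |s|) * ∏ i, (1 + |X i j|) := by
      intro j
      have hc := hcol1 j
      rcases σ (Sum.inr j) with k | k
      · have := (hle k j).trans (hcol k j)
        simp only [Matrix.fromBlocks_apply₁₂, Matrix.of_apply]
        nlinarith
      · simp only [Matrix.fromBlocks_apply₂₂, Matrix.smul_apply, Matrix.one_apply, smul_eq_mul,
          abs_mul, abs_neg]
        split_ifs
        · rw [abs_one]; nlinarith
        · rw [abs_zero]; nlinarith
    refine (mul_le_mul (Finset.prod_le_prod (fun _ _ => abs_nonneg _) fun i _ => hA i)
      (Finset.prod_le_prod (fun _ _ => abs_nonneg _) fun j _ => hB j)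
      (Finset.prod_nonneg fun _ _ => abs_nonneg _)
      (Finset.prod_nonneg fun i _ => zero_le_one.trans (hrow1 i))).trans (le_of_eq ?_)
    rw [Finset.prod_mul_distrib, Finset.prod_const, Finset.card_univ, Fintype.card_fin, entryBound,
      Finset.prod_comm (f := fun j i => 1 + |X i j|)]
    simp_rw [Finset.prod_pow]
    ring
  refine (Finset.sum_le_sum fun σ _ => hterm σ).trans (le_of_eq ?_)
  rw [Finset.sum_const, Finset.card_univ, Fintype.card_perm, nsmul_eq_mul]
  simp [mul_assoc]

/-- The matrix `X` without its `j`-th column. -/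
def removeCol {n m : ℕ} (j : Fin (m + 1)) (X : Fin n → Fin (m + 1) → ℝ) : Fin n → Fin m → ℝ :=
  fun i k => X i (j.succAbove k)

/-- Deleting row and column j of a Gram matrix amounts to deleting column j of X. This serves both
to bound the spectral derivative and to produce the term with one column fewer in the recursion. -/
lemma adjugate_gram_diag {n m : ℕ} (X : Fin n → Fin (m + 1) → ℝ) (s : ℝ) (j : Fin (m + 1)) :
    ((Matrix.of X)ᵀ * Matrix.of X - s • (1 : Matrix (Fin (m + 1)) (Fin (m + 1)) ℝ)).adjugate j j
      = gramDet (removeCol j X) s := by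
  rw [Matrix.adjugate_fin_succ_eq_det_submatrix, ← two_mul, pow_mul, neg_one_sq, one_pow, one_mul,
    gramDet]
  congr 1
  ext k l
  simp [removeCol, Matrix.mul_apply, Matrix.one_apply]

lemma entryBound_removeCol_le {n m : ℕ} (X : Fin n → Fin (m + 1) → ℝ) (j : Fin (m + 1)) :
    entryBound (removeCol j X) ≤ entryBound X := by
  refine Finset.prod_le_prod (fun i _ => by positivity) fun i _ => ?_
  rw [Fin.prod_univ_succAbove _ j]
  refine le_mul_of_one_le_left (by positivity) (one_le_pow₀ ?_)
  linarith [abs_nonneg (X i j)]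

/-- Uniformity over bounded s is what differentiation under the expectation requires. The derivative
is minus a sum of principal minors, each covered by the bound for the matrix without one column. -/
lemma exists_abs_gramDet_le (n m : ℕ) (R : ℝ) : ∃ C, 0 ≤ C ∧ ∀ s, |s| ≤ R →
    ∀ X : Fin n → Fin m → ℝ, |gramDet X s| ≤ C * entryBound X ∧
      |gramDet' X s| ≤ C * entryBound X := by
  rcases lt_or_ge R 0 with hR | hR
  · exact ⟨0, le_rfl, fun s hs => absurd (abs_nonneg s) (by linarith)⟩
  have hpow : ∀ k : ℕ, ∀ s, |s| ≤ R → (1 + |s|) ^ k ≤ (1 + R) ^ k := fun k s hs =>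
    pow_le_pow_left₀ (by positivity) (by linarith) k
  rcases m with _ | m
  · refine ⟨(n + 0)! * (1 + R) ^ 0, by positivity, fun s hs X => ⟨?_, ?_⟩⟩
    · refine (abs_gramDet_le X s).trans ?_
      have := (entryBound_pos X).le
      gcongr ?_ * ?_ * _
      exact hpow 0 s hs
    · have : gramDet' X s = 0 := by simp [gramDet']
      rw [this, abs_zero]
      have := (entryBound_pos X).le
      positivity
  · refine ⟨(n + (m + 1))! * (1 + R) ^ (m + 1) + (m + 1) * ((n + m)! * (1 + R) ^ m),
      by positivity, fun s hs X => ⟨?_, ?_⟩⟩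
    · refine (abs_gramDet_le X s).trans ?_
      have := (entryBound_pos X).le
      gcongr ?_ * _
      refine le_add_of_le_of_nonneg ?_ (by positivity)
      gcongr
    · have hb := (entryBound_pos X).le
      rw [gramDet', abs_neg, Matrix.trace]
      refine (Finset.abs_sum_le_sum_abs _ _).trans ?_
      have : ∀ j ∈ (Finset.univ : Finset (Fin (m + 1))),
          |Matrix.diag ((Matrix.of X)ᵀ * Matrix.of X -
            s • (1 : Matrix (Fin (m + 1)) (Fin (m + 1)) ℝ)).adjugate j| ≤
          (n + m)! * (1 + R) ^ m * entryBound X := by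
        intro j _
        rw [Matrix.diag_apply, adjugate_gram_diag]
        refine (abs_gramDet_le _ s).trans ?_
        have hb' := (entryBound_pos (removeCol j X)).le
        gcongr ?_ * ?_ * ?_
        · exact hpow m s hs
        · exact entryBound_removeCol_le X j
      refine (Finset.sum_le_sum this).trans ?_
      rw [Finset.sum_const, Finset.card_univ, Fintype.card_fin, nsmul_eq_mul, Nat.cast_add_one,
        ← mul_assoc]
      gcongr ?_ * _
      exact le_add_of_nonneg_left (by positivity)

end Bound

/-! ### Moments of quadratic forms in a random row -/

section Rows

lemma HasStandingMoments.integrable_pow {Q : Measure ℝ} [IsProbabilityMeasure Q] {b : ℝ}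
    (hQ : HasStandingMoments Q b) {k : ℕ} (hk : k ≤ 4) : Integrable (fun x : ℝ => x ^ k) Q := by
  have h : MemLp (id : ℝ → ℝ) k Q := hQ.memLp.mono_exponent (by exact_mod_cast hk)
  have h2 := h.integrable_norm_pow'
  refine h2.mono (by fun_prop) (ae_of_all _ fun x => ?_)
  simp

lemma HasStandingMoments.integral_sq {Q : Measure ℝ} [IsProbabilityMeasure Q] {b : ℝ}
    (hQ : HasStandingMoments Q b) : ∫ x, x ^ 2 ∂Q = 1 := by
  have h := hQ.variance_eq
  rw [variance_of_integral_eq_zero (by fun_prop) (by simpa using hQ.mean_eq)] at h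
  simpa using h

variable {m : ℕ}

/-- The multiplicity of `q` among `i, j, k, l`. -/
def indexCount (i j k l q : Fin m) : ℕ :=
  (if q = i then 1 else 0) + (if q = j then 1 else 0) + (if q = k then 1 else 0)
    + (if q = l then 1 else 0)

/-- Grouping equal indices writes the monomial as a product of functions of separate coordinates, so
its mean factors into moments of Q. -/
lemma prod_pow_indexCount (r : Fin m → ℝ) (i j k l : Fin m) :
    ∏ q, r q ^ indexCount i j k l q = r i * r j * r k * r l := by
  have h : ∀ i : Fin m, ∏ q, r q ^ (if q = i then 1 else 0) = r i := by
    intro i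
    rw [Finset.prod_eq_single i] <;> simp +contextual
  simp only [indexCount, pow_add, Finset.prod_mul_distrib, h]

variable {Q : Measure ℝ} [IsProbabilityMeasure Q] {b : ℝ}

lemma indexCount_le (i j k l q : Fin m) : indexCount i j k l q ≤ 4 := by
  unfold indexCount
  split_ifs <;> norm_num

lemma integrable_quartic (hQ : HasStandingMoments Q b) (i j k l : Fin m) :
    Integrable (fun r : Fin m → ℝ => r i * r j * r k * r l) (Measure.pi fun _ => Q) := by
  simp_rw [← prod_pow_indexCount]
  exact Integrable.fintype_prod (f := fun q (x : ℝ) => x ^ indexCount i j k l q)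
    fun q => hQ.integrable_pow (indexCount_le i j k l q)

/-- Wick's formula with the fourth cumulant b - 3 as correction when all indices coincide. The third
moment never appears: if an index occurs three times, the remaining one occurs once and contributes
the zero mean. -/
lemma integral_quartic (hQ : HasStandingMoments Q b) (i j k l : Fin m) :
    ∫ r : Fin m → ℝ, r i * r j * r k * r l ∂(Measure.pi fun _ => Q) =
      (if i = j then 1 else 0) * (if k = l then 1 else 0)
      + (if i = k then 1 else 0) * (if j = l then 1 else 0)
      + (if i = l then 1 else 0) * (if j = k then 1 else 0)
      + (b - 3) * ((if i = j then 1 else 0) * (if i = k then 1 else 0)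
        * (if i = l then 1 else 0)) := by
  simp_rw [← prod_pow_indexCount]
  rw [integral_fintype_prod_eq_prod (f := fun q (x : ℝ) => x ^ indexCount i j k l q)]
  have single : ∀ q, indexCount i j k l q = 1 → ∏ q, ∫ x, x ^ indexCount i j k l q ∂Q = 0 := by
    intro q hq
    refine Finset.prod_eq_zero (Finset.mem_univ q) ?_
    rw [hq]
    simpa using hQ.mean_eq
  have pair : (∀ q, indexCount i j k l q = 0 ∨ indexCount i j k l q = 2) →
      ∏ q, ∫ x, x ^ indexCount i j k l q ∂Q = 1 := by
    intro h
    refine Finset.prod_eq_one fun q _ => ?_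
    rcases h q with h | h
    · simp [h]
    · rw [h, hQ.integral_sq]
  by_cases hij : i = j
  · subst hij
    by_cases hkl : k = l
    · subst hkl
      by_cases hik : i = k
      · subst hik
        rw [Finset.prod_eq_single i]
        · simp [indexCount, hQ.fourth_eq]
          ring
        · intro q _ hq
          simp [indexCount, hq]
        · simp
      · rw [pair fun q => ?_]
        · simp [hik]
        · by_cases h : q = i
          · subst h; simp [indexCount, hik]
          · by_cases h' : q = k
            · subst h'; simp [indexCount, h]
            · simp [indexCount, h, h']
    · by_cases hik : i = k
      · subst hik
        rw [single l (by simp [indexCount, Ne.symm hkl])]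
        simp [hkl]
      · rw [single k (by simp [indexCount, Ne.symm hik, hkl])]
        simp [hkl, hik]
  · by_cases hik : i = k
    · subst hik
      by_cases hjl : j = l
      · subst hjl
        rw [pair fun q => ?_]
        · simp [hij]
        · by_cases h : q = i
          · subst h; simp [indexCount, hij]
          · by_cases h' : q = j
            · subst h'; simp [indexCount, h]
            · simp [indexCount, h, h']
      · rw [single j (by simp [indexCount, Ne.symm hij, hjl])]
        simp [hij, hjl, Ne.symm hij]
    · by_cases hil : i = l
      · subst hil
        by_cases hjk : j = k
        · subst hjk
          rw [pair fun q => ?_]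
          · simp [hij]
          · by_cases h : q = i
            · subst h; simp [indexCount, hij]
            · by_cases h' : q = j
              · subst h'; simp [indexCount, h]
              · simp [indexCount, h, h']
        · rw [single j (by simp [indexCount, Ne.symm hij, hjk])]
          simp [hij, hjk, hik]
      · rw [single i (by simp [indexCount, hij, hik, hil])]
        simp [hij, hik, hil]

lemma integrable_pow_indicator (hQ : HasStandingMoments Q b) (i j : Fin m) :
    Integrable (fun r : Fin m → ℝ => r i * r j) (Measure.pi fun _ => Q) := by
  have h : ∀ r : Fin m → ℝ, r i * r j =
      ∏ q, r q ^ ((if q = i then 1 else 0) + (if q = j then 1 else 0)) := by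
    intro r
    have h : ∀ i : Fin m, ∏ q, r q ^ (if q = i then 1 else 0) = r i := by
      intro i
      rw [Finset.prod_eq_single i] <;> simp +contextual
    simp only [pow_add, Finset.prod_mul_distrib, h]
  simp_rw [h]
  exact Integrable.fintype_prod
    (f := fun q (x : ℝ) => x ^ ((if q = i then 1 else 0) + (if q = j then 1 else 0)))
    fun q => hQ.integrable_pow (by split_ifs <;> norm_num)

lemma integral_quadratic (hQ : HasStandingMoments Q b) (i j : Fin m) :
    ∫ r : Fin m → ℝ, r i * r j ∂(Measure.pi fun _ => Q) = if i = j then 1 else 0 := by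
  have h : ∀ r : Fin m → ℝ, r i * r j =
      ∏ q, r q ^ ((if q = i then 1 else 0) + (if q = j then 1 else 0)) := by
    intro r
    have h : ∀ i : Fin m, ∏ q, r q ^ (if q = i then 1 else 0) = r i := by
      intro i
      rw [Finset.prod_eq_single i] <;> simp +contextual
    simp only [pow_add, Finset.prod_mul_distrib, h]
  simp_rw [h]
  rw [integral_fintype_prod_eq_prod
    (f := fun q (x : ℝ) => x ^ ((if q = i then 1 else 0) + (if q = j then 1 else 0)))]
  by_cases hij : i = j
  · subst hij
    rw [if_pos rfl]
    refine Finset.prod_eq_one fun q _ => ?_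
    by_cases hq : q = i
    · simp [hq, hQ.integral_sq]
    · simp [hq]
  · rw [if_neg hij]
    refine Finset.prod_eq_zero (Finset.mem_univ i) ?_
    simpa [hij] using hQ.mean_eq

/-- Second mixed moment of two affine-quadratic forms in a random row. -/
lemma integral_quadForm_mul (hQ : HasStandingMoments Q b) (p q : ℝ)
    (U V : Matrix (Fin m) (Fin m) ℝ) (hV : V.IsSymm) :
    ∫ r : Fin m → ℝ, (p + r ⬝ᵥ (U *ᵥ r)) * (q + r ⬝ᵥ (V *ᵥ r)) ∂(Measure.pi fun _ => Q) =
      (p + U.trace) * (q + V.trace) + 2 * (U * V).trace + (b - 3) * ∑ j, U j j * V j j := by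
  have hexp : ∀ (r : Fin m → ℝ) (W : Matrix (Fin m) (Fin m) ℝ),
      r ⬝ᵥ (W *ᵥ r) = ∑ x : Fin m × Fin m, W x.1 x.2 * (r x.1 * r x.2) := by
    intro r W
    simp only [dotProduct, Matrix.mulVec, Finset.mul_sum, Fintype.sum_prod_type]
    exact Finset.sum_congr rfl fun i _ => Finset.sum_congr rfl fun j _ => by ring
  have hmul : ∀ r : Fin m → ℝ, (p + r ⬝ᵥ (U *ᵥ r)) * (q + r ⬝ᵥ (V *ᵥ r)) =
      p * q + p * (∑ x : Fin m × Fin m, V x.1 x.2 * (r x.1 * r x.2))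
      + q * (∑ x : Fin m × Fin m, U x.1 x.2 * (r x.1 * r x.2))
      + ∑ x : Fin m × Fin m, ∑ y : Fin m × Fin m,
        U x.1 x.2 * V y.1 y.2 * (r x.1 * r x.2 * r y.1 * r y.2) := by
    intro r
    rw [hexp, hexp]
    have : (∑ x : Fin m × Fin m, U x.1 x.2 * (r x.1 * r x.2)) *
        (∑ x : Fin m × Fin m, V x.1 x.2 * (r x.1 * r x.2)) =
        ∑ x : Fin m × Fin m, ∑ y : Fin m × Fin m,
        U x.1 x.2 * V y.1 y.2 * (r x.1 * r x.2 * r y.1 * r y.2) := by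
      rw [Finset.sum_mul_sum]
      exact Finset.sum_congr rfl fun i _ => Finset.sum_congr rfl fun j _ => by ring
    rw [← this]; ring
  have hquad : ∀ W : Matrix (Fin m) (Fin m) ℝ, Integrable (fun r : Fin m → ℝ =>
      ∑ x : Fin m × Fin m, W x.1 x.2 * (r x.1 * r x.2)) (Measure.pi fun _ => Q) := fun W =>
    integrable_finsetSum _ fun x _ => (integrable_pow_indicator hQ x.1 x.2).const_mul _
  have hquadI : ∀ W : Matrix (Fin m) (Fin m) ℝ, ∫ r : Fin m → ℝ,
      ∑ x : Fin m × Fin m, W x.1 x.2 * (r x.1 * r x.2) ∂(Measure.pi fun _ => Q) = W.trace := by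
    intro W
    rw [integral_finsetSum _ fun x _ => (integrable_pow_indicator hQ x.1 x.2).const_mul _]
    simp_rw [integral_const_mul, integral_quadratic hQ, Fintype.sum_prod_type]
    simp [Matrix.trace]
  have hq4 : ∀ x y : Fin m × Fin m, Integrable (fun r : Fin m → ℝ =>
      U x.1 x.2 * V y.1 y.2 * (r x.1 * r x.2 * r y.1 * r y.2)) (Measure.pi fun _ => Q) :=
    fun x y => (integrable_quartic hQ _ _ _ _).const_mul _
  simp_rw [hmul]
  rw [integral_add, integral_add, integral_add, integral_const, integral_const_mul,
    integral_const_mul, hquadI, hquadI, integral_finsetSum _ fun x _ => integrable_finsetSum _ fun y _ => hq4 x y]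
  rotate_left
  · exact integrable_const _
  · exact (hquad V).const_mul _
  · exact (integrable_const _).add ((hquad V).const_mul _)
  · exact (hquad U).const_mul _
  · exact ((integrable_const _).add ((hquad V).const_mul _)).add ((hquad U).const_mul _)
  · exact integrable_finsetSum _ fun x _ => integrable_finsetSum _ fun y _ => hq4 x y
  simp_rw [integral_finsetSum _ fun y _ => hq4 _ y, integral_const_mul, integral_quartic hQ,
    mul_add, Finset.sum_add_distrib, Fintype.sum_prod_type]
  -- The pairing i = k, j = l gives the trace of U Vᵀ; symmetry of V merges it with the pairing i =
  -- l, j = k, hence the factor 2.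
  have hVs : ∀ i j, V i j = V j i := fun i j => hV.apply j i
  have e1 : ∑ i, ∑ j, ∑ k, ∑ l, U i j * V k l *
      ((if i = j then (1 : ℝ) else 0) * if k = l then 1 else 0) = U.trace * V.trace := by
    simp [Matrix.trace, Finset.sum_mul_sum]
  have e2 : ∑ i, ∑ j, ∑ k, ∑ l, U i j * V k l *
      ((if i = k then (1 : ℝ) else 0) * if j = l then 1 else 0) = (U * V).trace := by
    simp [Matrix.trace, Matrix.mul_apply]
    exact Finset.sum_congr rfl fun i _ => Finset.sum_congr rfl fun j _ => by rw [hVs]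
  have e3 : ∑ i, ∑ j, ∑ k, ∑ l, U i j * V k l *
      ((if i = l then (1 : ℝ) else 0) * if j = k then 1 else 0) = (U * V).trace := by
    simp [Matrix.trace, Matrix.mul_apply]
  have e4 : ∑ i, ∑ j, ∑ k, ∑ l, U i j * V k l *
      ((b - 3) * ((if i = j then (1 : ℝ) else 0) * (if i = k then 1 else 0) *
        if i = l then 1 else 0)) = (b - 3) * ∑ j, U j j * V j j := by
    simp [Finset.mul_sum]
    exact Finset.sum_congr rfl fun i _ => by ring
  rw [e1, e2, e3, e4]
  simp
  ring

end Rows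

/-! ### The recursion for the correlation function of the product law -/

section GramExpectation

/-- The law of an `n × m` matrix with independent entries of law `Q`. -/
noncomputable abbrev matrixLaw (Q : Measure ℝ) (n m : ℕ) : Measure (Fin n → Fin m → ℝ) :=
  Measure.pi fun _ => Measure.pi fun _ => Q

variable {Q : Measure ℝ} [IsProbabilityMeasure Q] {b : ℝ} {n m : ℕ}

lemma integrable_entryBound_sq (hQ : HasStandingMoments Q b) :
    Integrable (fun X : Fin n → Fin m → ℝ => entryBound X * entryBound X) (matrixLaw Q n m) := by
  have h1 : Integrable (fun x : ℝ => (1 + |x|) ^ 2 * (1 + |x|) ^ 2) Q := by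
    -- By convexity (1 + |x|)⁴ ≤ 8 (1 + x⁴).
    refine (((integrable_const (1 : ℝ)).add (hQ.integrable_pow le_rfl)).const_mul 8).mono'
      (by fun_prop) (ae_of_all _ fun x => ?_)
    have hx : x ^ 4 = |x| ^ 4 := by rw [← abs_pow, abs_of_nonneg (by positivity)]
    rw [Real.norm_of_nonneg (by positivity), Pi.add_apply, hx]
    have := abs_nonneg x
    nlinarith [sq_nonneg (|x| - 1), sq_nonneg (|x| ^ 2 - 1), sq_nonneg (|x| ^ 2 - |x|),
      sq_nonneg ((|x| - 1) ^ 2)]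
  simp_rw [entryBound, ← Finset.prod_mul_distrib]
  exact Integrable.fintype_prod
    (f := fun _ (r : Fin m → ℝ) => ∏ j, ((1 + |r j|) ^ 2 * (1 + |r j|) ^ 2)) fun _ =>
    Integrable.fintype_prod (f := fun _ (x : ℝ) => (1 + |x|) ^ 2 * (1 + |x|) ^ 2) fun _ => h1

/-- Functions dominated by the basic bound. -/
def EntryDominated (W : (Fin n → Fin m → ℝ) → ℝ) : Prop :=
  Continuous W ∧ ∃ C, 0 ≤ C ∧ ∀ X, |W X| ≤ C * entryBound X

lemma entryDominated_gramDet (s : ℝ) :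
    EntryDominated fun X : Fin n → Fin m → ℝ => gramDet X s := by
  obtain ⟨C, hC, h⟩ := exists_abs_gramDet_le n m |s|
  exact ⟨continuous_gramDet s, C, hC, fun X => (h s le_rfl X).1⟩

lemma entryDominated_gramDet' (s : ℝ) :
    EntryDominated fun X : Fin n → Fin m → ℝ => gramDet' X s := by
  obtain ⟨C, hC, h⟩ := exists_abs_gramDet_le n m |s|
  exact ⟨continuous_gramDet' s, C, hC, fun X => (h s le_rfl X).2⟩

lemma entryDominated_gramDet_removeCol (s : ℝ) (j : Fin (m + 1)) :
    EntryDominated fun X : Fin n → Fin (m + 1) → ℝ => gramDet (removeCol j X) s := by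
  obtain ⟨C, hC, h⟩ := exists_abs_gramDet_le n m |s|
  refine ⟨(continuous_gramDet s).comp (by unfold removeCol; fun_prop), C, hC, fun X => ?_⟩
  exact ((h s le_rfl _).1).trans (mul_le_mul_of_nonneg_left (entryBound_removeCol_le X j) hC)

lemma EntryDominated.integrable_mul (hQ : HasStandingMoments Q b)
    {V W : (Fin n → Fin m → ℝ) → ℝ} (hV : EntryDominated V) (hW : EntryDominated W) :
    Integrable (fun X => V X * W X) (matrixLaw Q n m) := by
  obtain ⟨hVc, C, hC, hV⟩ := hV
  obtain ⟨hWc, D, hD, hW⟩ := hW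
  refine ((integrable_entryBound_sq hQ).const_mul (C * D)).mono'
    (hVc.mul hWc).aestronglyMeasurable (ae_of_all _ fun X => ?_)
  rw [Real.norm_eq_abs, abs_mul]
  have := entryBound_pos X
  calc |V X| * |W X| ≤ (C * entryBound X) * (D * entryBound X) :=
        mul_le_mul (hV X) (hW X) (abs_nonneg _) (by positivity)
    _ = _ := by ring

/-- The cofactor W is kept general so that `gramDet` yields the first derivatives of the correlation
function and `gramDet'` the mixed one. -/
lemma hasDerivAt_integral_gramDet_mul (hQ : HasStandingMoments Q b)
    {W : (Fin n → Fin m → ℝ) → ℝ} (hW : EntryDominated W) (s : ℝ) :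
    HasDerivAt (fun s => ∫ X, gramDet X s * W X ∂(matrixLaw Q n m))
      (∫ X, gramDet' X s * W X ∂(matrixLaw Q n m)) s := by
  obtain ⟨C, hC, h⟩ := exists_abs_gramDet_le n m (|s| + 1)
  obtain ⟨hWc, D, hD, hWb⟩ := hW
  refine (hasDerivAt_integral_of_dominated_loc_of_deriv_le
    (F := fun s X => gramDet X s * W X) (F' := fun s X => gramDet' X s * W X)
    (bound := fun X => (C * D) * (entryBound X * entryBound X)) (Metric.ball_mem_nhds s one_pos)
    (Eventually.of_forall fun x => ((continuous_gramDet x).mul hWc).aestronglyMeasurable)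
    ((entryDominated_gramDet s).integrable_mul hQ ⟨hWc, D, hD, hWb⟩)
    ((continuous_gramDet' s).mul hWc).aestronglyMeasurable
    (ae_of_all _ fun X x hx => ?_) ((integrable_entryBound_sq hQ).const_mul _)
    (ae_of_all _ fun X x _ => (hasDerivAt_gramDet X x).mul_const _)).2
  have hx' : |x| ≤ |s| + 1 := by
    rw [Metric.mem_ball, Real.dist_eq] at hx
    have := abs_sub_abs_le_abs_sub x s
    linarith
  rw [Real.norm_eq_abs, abs_mul]
  have := entryBound_pos X
  calc |gramDet' X x| * |W X| ≤ (C * entryBound X) * (D * entryBound X) :=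
        mul_le_mul (h x hx' X).2 (hWb X) (abs_nonneg _) (by positivity)
    _ = _ := by ring

lemma gram_cons (r : Fin m → ℝ) (X : Fin n → Fin m → ℝ) (s : ℝ) :
    (Matrix.of (Fin.cons r X : Fin (n + 1) → Fin m → ℝ))ᵀ *
      Matrix.of (Fin.cons r X : Fin (n + 1) → Fin m → ℝ) - s • (1 : Matrix (Fin m) (Fin m) ℝ) =
    ((Matrix.of X)ᵀ * Matrix.of X - s • (1 : Matrix (Fin m) (Fin m) ℝ))
      + Matrix.vecMulVec r r := by
  ext i j
  simp [Matrix.mul_apply, Fin.sum_univ_succ, Matrix.vecMulVec_apply]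
  ring

lemma gramDet_cons (r : Fin m → ℝ) (X : Fin n → Fin m → ℝ) (s : ℝ) :
    gramDet (Fin.cons r X : Fin (n + 1) → Fin m → ℝ) s = gramDet X s + r ⬝ᵥ
      (((Matrix.of X)ᵀ * Matrix.of X - s • (1 : Matrix (Fin m) (Fin m) ℝ)).adjugate *ᵥ r) := by
  rw [gramDet, gram_cons, Matrix.det_add_vecMulVec, gramDet]

lemma isSymm_adjugate_gram (X : Fin n → Fin m → ℝ) (s : ℝ) :
    ((Matrix.of X)ᵀ * Matrix.of X - s • (1 : Matrix (Fin m) (Fin m) ℝ)).adjugate.IsSymm := by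
  apply Matrix.IsSymm.adjugate
  simp [Matrix.IsSymm, Matrix.transpose_mul]

lemma integral_matrixLaw_succ {G : (Fin (n + 1) → Fin m → ℝ) → ℝ}
    (hG : Integrable G (matrixLaw Q (n + 1) m)) :
    ∫ X, G X ∂(matrixLaw Q (n + 1) m) =
      ∫ X, ∫ r, G (Fin.cons r X) ∂(Measure.pi fun _ => Q) ∂(matrixLaw Q n m) := by
  have hmp := (measurePreserving_piFinSuccAbove
    (fun _ : Fin (n + 1) => (Measure.pi fun _ : Fin m => Q)) 0).symm
  rw [← hmp.integral_comp', integral_prod_symm]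
  · simp [MeasurableEquiv.piFinSuccAbove_symm_apply, Fin.insertNthEquiv]
  · exact hmp.integrable_comp_of_integrable hG

/-- Averaging over one row. -/
lemma integral_row (hQ : HasStandingMoments Q b) (X : Fin n → Fin m → ℝ) {s t : ℝ}
    (hst : s ≠ t) :
    ∫ r, gramDet (Fin.cons r X : Fin (n + 1) → Fin m → ℝ) s *
      gramDet (Fin.cons r X : Fin (n + 1) → Fin m → ℝ) t ∂(Measure.pi fun _ => Q) =
    (gramDet X s - gramDet' X s) * (gramDet X t - gramDet' X t)
      + 2 / (s - t) * (gramDet X s * gramDet' X t - gramDet' X s * gramDet X t)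
      + (b - 3) * ∑ j,
        ((Matrix.of X)ᵀ * Matrix.of X - s • (1 : Matrix (Fin m) (Fin m) ℝ)).adjugate j j *
        ((Matrix.of X)ᵀ * Matrix.of X - t • (1 : Matrix (Fin m) (Fin m) ℝ)).adjugate j j := by
  simp_rw [gramDet_cons]
  rw [integral_quadForm_mul hQ _ _ _ _ (isSymm_adjugate_gram X t)]
  -- The trace of the product of adjugates becomes a divided difference, at the price of s ≠ t; the
  -- diagonal is recovered later by continuity.
  have h := Matrix.sub_mul_trace_adjugate_mul_adjugate ((Matrix.of X)ᵀ * Matrix.of X) s t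
  have hst' : s - t ≠ 0 := sub_ne_zero.2 hst
  simp only [gramDet', sub_neg_eq_add]
  congr 2
  rw [div_mul_eq_mul_div, eq_div_iff hst', mul_assoc, mul_comm _ (s - t), h, gramDet, gramDet]
  ring

lemma measurePreserving_removeCol (j : Fin (m + 1)) :
    MeasurePreserving (removeCol j) (matrixLaw Q n (m + 1)) (matrixLaw Q n m) := by
  refine measurePreserving_pi (fun _ => Measure.pi fun _ => Q) (fun _ => Measure.pi fun _ => Q)
    (f := fun _ (r : Fin (m + 1) → ℝ) k => r (j.succAbove k)) fun _ => ?_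
  exact (measurePreserving_snd (μ := Q) (ν := Measure.pi fun _ : Fin m => Q)).comp
    (measurePreserving_piFinSuccAbove (fun _ : Fin (m + 1) => Q) j)

lemma integral_removeCol (j : Fin (m + 1)) {G : (Fin n → Fin m → ℝ) → ℝ} (hG : Continuous G) :
    ∫ X, G (removeCol j X) ∂(matrixLaw Q n (m + 1)) = ∫ X, G X ∂(matrixLaw Q n m) := by
  have h := measurePreserving_removeCol (Q := Q) (n := n) j
  rw [← h.map_eq, integral_map h.measurable.aemeasurable hG.aestronglyMeasurable]

/-- The second-order correlation function of the product law. -/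
noncomputable def gramCorr (Q : Measure ℝ) (n m : ℕ) (s t : ℝ) : ℝ :=
  ∫ X, gramDet X s * gramDet X t ∂(matrixLaw Q n m)

/-- The recursion of `gramCorr` in the number of rows. -/
lemma gramCorr_succ_succ (hQ : HasStandingMoments Q b) (n m : ℕ) {s t : ℝ} (hst : s ≠ t) :
    gramCorr Q (n + 1) (m + 1) s t =
      gramCorr Q n (m + 1) s t
      - ∫ X, gramDet' X s * gramDet X t ∂(matrixLaw Q n (m + 1))
      - ∫ X, gramDet X s * gramDet' X t ∂(matrixLaw Q n (m + 1))
      + ∫ X, gramDet' X s * gramDet' X t ∂(matrixLaw Q n (m + 1))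
      + 2 / (s - t) * ((∫ X, gramDet X s * gramDet' X t ∂(matrixLaw Q n (m + 1)))
        - ∫ X, gramDet' X s * gramDet X t ∂(matrixLaw Q n (m + 1)))
      + (b - 3) * ((m + 1) * gramCorr Q n m s t) := by
  have d0 := entryDominated_gramDet (n := n) (m := m + 1)
  have d1 := entryDominated_gramDet' (n := n) (m := m + 1)
  have i00 := (d0 s).integrable_mul hQ (d0 t)
  have i10 := (d1 s).integrable_mul hQ (d0 t)
  have i01 := (d0 s).integrable_mul hQ (d1 t)
  have i11 := (d1 s).integrable_mul hQ (d1 t)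
  have ij : ∀ j : Fin (m + 1), Integrable (fun X : Fin n → Fin (m + 1) → ℝ =>
      gramDet (removeCol j X) s * gramDet (removeCol j X) t) (matrixLaw Q n (m + 1)) := fun j =>
    (entryDominated_gramDet_removeCol s j).integrable_mul hQ (entryDominated_gramDet_removeCol t j)
  rw [gramCorr, integral_matrixLaw_succ
    ((entryDominated_gramDet s).integrable_mul hQ (entryDominated_gramDet t))]
  simp_rw [integral_row hQ _ hst, adjugate_gram_diag]
  have hsum : ∀ X : Fin n → Fin (m + 1) → ℝ,
      (gramDet X s - gramDet' X s) * (gramDet X t - gramDet' X t)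
      + 2 / (s - t) * (gramDet X s * gramDet' X t - gramDet' X s * gramDet X t)
      + (b - 3) * ∑ j, gramDet (removeCol j X) s * gramDet (removeCol j X) t =
      gramDet X s * gramDet X t - gramDet' X s * gramDet X t - gramDet X s * gramDet' X t
      + gramDet' X s * gramDet' X t
      + 2 / (s - t) * (gramDet X s * gramDet' X t - gramDet' X s * gramDet X t)
      + (b - 3) * ∑ j, gramDet (removeCol j X) s * gramDet (removeCol j X) t := fun X => by ring
  simp_rw [hsum]
  have j1 : Integrable (fun X : Fin n → Fin (m + 1) → ℝ => gramDet X s * gramDet X t -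
      gramDet' X s * gramDet X t) (matrixLaw Q n (m + 1)) := i00.sub i10
  have j2 : Integrable (fun X : Fin n → Fin (m + 1) → ℝ => gramDet X s * gramDet X t -
      gramDet' X s * gramDet X t - gramDet X s * gramDet' X t) (matrixLaw Q n (m + 1)) := j1.sub i01
  have j3 : Integrable (fun X : Fin n → Fin (m + 1) → ℝ => gramDet X s * gramDet X t -
      gramDet' X s * gramDet X t - gramDet X s * gramDet' X t + gramDet' X s * gramDet' X t)
      (matrixLaw Q n (m + 1)) := j2.add i11
  have j4 : Integrable (fun X : Fin n → Fin (m + 1) → ℝ =>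
      2 / (s - t) * (gramDet X s * gramDet' X t - gramDet' X s * gramDet X t))
      (matrixLaw Q n (m + 1)) := (i01.sub i10).const_mul _
  have j5 : Integrable (fun X : Fin n → Fin (m + 1) → ℝ => gramDet X s * gramDet X t -
      gramDet' X s * gramDet X t - gramDet X s * gramDet' X t + gramDet' X s * gramDet' X t
      + 2 / (s - t) * (gramDet X s * gramDet' X t - gramDet' X s * gramDet X t))
      (matrixLaw Q n (m + 1)) := j3.add j4
  rw [integral_add j5 ((integrable_finsetSum _ fun j _ => ij j).const_mul _),
    integral_add j3 j4, integral_add j2 i11, integral_sub j1 i01,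
    integral_sub i00 i10, integral_const_mul, integral_sub i01 i10, integral_const_mul,
    integral_finsetSum _ fun j _ => ij j]
  -- Whichever column is removed, the remaining matrix has the same law, so the diagonal sum gives m
  -- + 1 equal terms.
  have hcol : ∀ j : Fin (m + 1), ∫ X, gramDet (removeCol j X) s * gramDet (removeCol j X) t
      ∂(matrixLaw Q n (m + 1)) = gramCorr Q n m s t := fun j =>
    integral_removeCol (G := fun X => gramDet X s * gramDet X t) j
      ((continuous_gramDet s).mul (continuous_gramDet t))
  simp_rw [hcol]
  simp [gramCorr]

lemma gramCorr_zero_left (m : ℕ) (s t : ℝ) : gramCorr Q 0 m s t = (s * t) ^ m := by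
  have h : ∀ (X : Fin 0 → Fin m → ℝ) (s : ℝ), gramDet X s = (-s) ^ m := by
    intro X s
    have : (Matrix.of X)ᵀ * Matrix.of X = 0 := by
      ext i j; simp [Matrix.mul_apply]
    rw [gramDet, this, zero_sub, ← neg_smul, Matrix.det_smul]
    simp
  simp_rw [gramCorr, h, ← mul_pow]
  simp

lemma gramCorr_zero_right (n : ℕ) (s t : ℝ) : gramCorr Q n 0 s t = 1 := by
  simp [gramCorr, gramDet]

/-- The law of a matrix with i.i.d. entries. -/
lemma IsIIDMatrix.map_eq {Ω : Type*} [MeasurableSpace Ω] {P : Measure Ω} [IsProbabilityMeasure P]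
    {X : Ω → Matrix (Fin n) (Fin m) ℝ} (hX : IsIIDMatrix X Q P) :
    AEMeasurable (fun ω i j => X ω i j) P ∧
      P.map (fun ω i j => X ω i j) = matrixLaw Q n m := by
  have hae : ∀ p : Fin n × Fin m, AEMeasurable (fun ω => X ω p.1 p.2) P := fun p =>
    (hX.hasLaw p.1 p.2).aemeasurable
  have h1 : P.map (fun ω (p : Fin n × Fin m) => X ω p.1 p.2) = Measure.pi fun _ => Q := by
    rw [(iIndepFun_iff_map_fun_eq_pi_map hae).1 hX.indep]
    congr 1
    ext1 p
    exact (hX.hasLaw p.1 p.2).map_eq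
  have hae2 : AEMeasurable (fun ω i j => X ω i j) P :=
    aemeasurable_pi_lambda _ fun i => aemeasurable_pi_lambda _ fun j => hae (i, j)
  refine ⟨hae2, ?_⟩
  have hcur : Measurable fun (f : Fin n × Fin m → ℝ) i j => f (i, j) := by fun_prop
  have hunc : Measurable fun (f : Fin n → Fin m → ℝ) (p : Fin n × Fin m) => f p.1 p.2 := by
    fun_prop
  have h2 : (matrixLaw Q n m).map (fun f (p : Fin n × Fin m) => f p.1 p.2) =
      Measure.pi fun _ => Q := by
    symm
    refine Measure.pi_eq fun s hs => ?_
    rw [Measure.map_apply hunc (MeasurableSet.univ_pi hs)]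
    have : (fun (f : Fin n → Fin m → ℝ) (p : Fin n × Fin m) => f p.1 p.2) ⁻¹' (Set.univ.pi s) =
        Set.univ.pi fun i => Set.univ.pi fun j => s (i, j) := by
      ext f; simp [Set.mem_pi]
    rw [this, Measure.pi_pi]
    simp_rw [Measure.pi_pi]
    rw [Fintype.prod_prod_type]
  have h3 : P.map (fun ω i j => X ω i j) =
      (P.map (fun ω (p : Fin n × Fin m) => X ω p.1 p.2)).map (fun f i j => f (i, j)) := by
    rw [AEMeasurable.map_map_of_aemeasurable hcur.aemeasurable (aemeasurable_pi_lambda _ hae)]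
    rfl
  rw [h3, h1, ← h2, Measure.map_map hcur hunc]
  exact Measure.map_id

lemma IsIIDMatrix.integrable_charPolyProduct {Ω : Type*} [MeasurableSpace Ω] {P : Measure Ω}
    [IsProbabilityMeasure P] {X : Ω → Matrix (Fin n) (Fin m) ℝ} (hX : IsIIDMatrix X Q P)
    (hQ : HasStandingMoments Q b) (s t : ℝ) :
    Integrable (fun ω => charPolyProduct (X ω) s t) P := by
  obtain ⟨hae, hmap⟩ := hX.map_eq
  have h := (entryDominated_gramDet (n := n) (m := m) s).integrable_mul hQ
    (entryDominated_gramDet t)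
  rw [← hmap] at h
  exact h.comp_aemeasurable hae

lemma IsIIDMatrix.secondCorrelation_eq {Ω : Type*} [MeasurableSpace Ω] {P : Measure Ω}
    [IsProbabilityMeasure P] {X : Ω → Matrix (Fin n) (Fin m) ℝ} (hX : IsIIDMatrix X Q P)
    (s t : ℝ) : secondCorrelation X P s t = gramCorr Q n m s t := by
  obtain ⟨hae, hmap⟩ := hX.map_eq
  have hc : Continuous fun X : Fin n → Fin m → ℝ => gramDet X s * gramDet X t :=
    (continuous_gramDet s).mul (continuous_gramDet t)
  rw [gramCorr, ← hmap, integral_map hae hc.aestronglyMeasurable]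
  rfl

end GramExpectation

/-! ### The generating function and coefficient extraction on circles -/

section TorusCoefficients

/-- The generating function of the normalised correlation functions. -/
noncomputable def genFun (c s t : ℝ) (x y : ℂ) : ℂ :=
  Complex.exp ((x + s * t * y - (s + t) * (x * y)) / (1 - x * y) + c * (x * y)) / (1 - x * y) ^ 3

/-- The logarithmic derivative of `genFun` in `s`. -/
noncomputable def genFunDlog (t : ℝ) (x y : ℂ) : ℂ := (t * y - x * y) / (1 - x * y)

lemma hasDerivAt_genFun_left (c s t : ℝ) (x y : ℂ) :
    HasDerivAt (fun s : ℝ => genFun c s t x y) (genFun c s t x y * genFunDlog t x y) s := by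
  have h : HasDerivAt (fun s : ℂ => Complex.exp ((x + s * t * y - (s + t) * (x * y)) / (1 - x * y)
      + c * (x * y)) / (1 - x * y) ^ 3) (genFun c s t x y * genFunDlog t x y) (s : ℂ) := by
    have h1 : HasDerivAt (fun s : ℂ => (x + s * t * y - (s + t) * (x * y)) / (1 - x * y)
        + c * (x * y)) (genFunDlog t x y) (s : ℂ) := by
      have := ((((((hasDerivAt_id (s : ℂ)).mul_const (t : ℂ)).mul_const y).const_add x).sub
        (((hasDerivAt_id (s : ℂ)).add_const (t : ℂ)).mul_const (x * y))).div_const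
        (1 - x * y)).add_const (c * (x * y))
      refine this.congr_deriv ?_
      simp [genFunDlog]
    refine (h1.cexp.div_const _).congr_deriv ?_
    rw [genFun]; ring
  exact h.comp_ofReal

lemma genFun_comm (c s t : ℝ) (x y : ℂ) : genFun c s t x y = genFun c t s x y := by
  simp only [genFun]; ring_nf

lemma hasDerivAt_genFun_right (c s t : ℝ) (x y : ℂ) :
    HasDerivAt (fun t : ℝ => genFun c s t x y) (genFun c s t x y * genFunDlog s x y) t := by
  simp_rw [genFun_comm c s]
  exact hasDerivAt_genFun_left c t s x y

lemma hasDerivAt_genFunDlog (t : ℝ) (x y : ℂ) :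
    HasDerivAt (fun t : ℝ => genFunDlog t x y) (y / (1 - x * y)) t := by
  have h : HasDerivAt (fun t : ℂ => (t * y - x * y) / (1 - x * y)) (y / (1 - x * y)) (t : ℂ) := by
    simpa using (((hasDerivAt_id (t : ℂ)).mul_const y).sub_const (x * y)).div_const (1 - x * y)
  exact h.comp_ofReal

/-- The logarithmic derivative of `genFun` in `x`. -/
noncomputable def genFunDlogX (c s t : ℝ) (x y : ℂ) : ℂ :=
  1 - genFunDlog t x y - genFunDlog s x y + genFunDlog s x y * genFunDlog t x y
    + 3 * (y / (1 - x * y)) + c * y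

/-- The differential equation of `genFun` in `x`. -/
lemma hasDerivAt_genFun_x (c s t : ℝ) {x y : ℂ} (hxy : 1 - x * y ≠ 0) :
    HasDerivAt (fun x => genFun c s t x y) (genFun c s t x y * genFunDlogX c s t x y) x := by
  have hx := hasDerivAt_id x
  have hd : HasDerivAt (fun x => 1 - x * y) (-y) x := by
    simpa using (hx.mul_const y).const_sub 1
  have hn : HasDerivAt (fun x => x + s * t * y - (s + t) * (x * y)) (1 - (s + t) * y) x := by
    simpa using (hx.add_const (s * t * y)).fun_sub ((hx.mul_const y).const_mul ((s : ℂ) + t))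
  have he : HasDerivAt (fun x => c * (x * y)) (c * y) x := by
    simpa using (hx.mul_const y).const_mul (c : ℂ)
  refine (((hn.div hd hxy).add he).cexp.div (hd.pow 3) (pow_ne_zero 3 hxy)).congr_deriv ?_
  simp only [genFun, genFunDlogX, genFunDlog, Pi.add_apply, Pi.div_apply, Pi.pow_apply]
  field_simp
  ring

/-- Differentiation under the integral sign over a compact set. -/
lemma hasDerivAt_setIntegral_of_continuous {K : Set (ℝ × ℝ)} (hK : IsCompact K)
    {G G' : ℝ → ℝ × ℝ → ℂ} (hG : ∀ s, Continuous (G s)) (hG' : Continuous (Function.uncurry G'))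
    (hd : ∀ s p, HasDerivAt (fun s => G s p) (G' s p) s) (s : ℝ) :
    HasDerivAt (fun s => ∫ p in K, G s p) (∫ p in K, G' s p) s := by
  obtain ⟨C, hC⟩ := ((isCompact_closedBall s 1).prod hK).exists_bound_of_continuousOn
    hG'.continuousOn
  have hG's : Continuous (G' s) := hG'.comp (by fun_prop : Continuous fun p : ℝ × ℝ => (s, p))
  have : IsFiniteMeasure (volume.restrict K) := ⟨by simpa using hK.measure_lt_top⟩
  refine (hasDerivAt_integral_of_dominated_loc_of_deriv_le (bound := fun _ => C)
    (Metric.ball_mem_nhds s one_pos) (Eventually.of_forall fun x => (hG x).aestronglyMeasurable)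
    ((hG s).continuousOn.integrableOn_compact hK) hG's.aestronglyMeasurable ?_
    (integrable_const C) (ae_of_all _ fun p x _ => hd x p)).2
  filter_upwards [ae_restrict_mem hK.measurableSet] with p hp x hx
  exact hC (x, p) ⟨Metric.ball_subset_closedBall hx, hp⟩

/-- The square of angles. -/
def angleSquare : Set (ℝ × ℝ) := Set.Icc (-Real.pi) Real.pi ×ˢ Set.Icc (-Real.pi) Real.pi

lemma isCompact_angleSquare : IsCompact angleSquare := isCompact_Icc.prod isCompact_Icc

lemma integral_angleSquare {G : ℝ × ℝ → ℂ} (hG : Continuous G) :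
    ∫ p in angleSquare, G p =
      ∫ η in (-Real.pi)..Real.pi, ∫ θ in (-Real.pi)..Real.pi, G (η, θ) := by
  have hle : -Real.pi ≤ Real.pi := by linarith [Real.pi_pos]
  rw [angleSquare, Measure.volume_eq_prod, setIntegral_prod _
    (hG.continuousOn.integrableOn_compact isCompact_angleSquare)]
  simp_rw [integral_Icc_eq_integral_Ioc, intervalIntegral.integral_of_le hle]

lemma integral_angleSquare_swap {G : ℝ × ℝ → ℂ} (hG : Continuous G) :
    ∫ p in angleSquare, G p =
      ∫ θ in (-Real.pi)..Real.pi, ∫ η in (-Real.pi)..Real.pi, G (η, θ) := by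
  have hG' : Continuous fun p : ℝ × ℝ => G p.swap := hG.comp continuous_swap
  have h := integral_angleSquare hG'
  simp only [Prod.swap_prod_mk] at h
  rw [← h, angleSquare, Measure.volume_eq_prod, setIntegral_prod_swap]

lemma circleMap_pi_eq (ρ : ℝ) : circleMap 0 ρ Real.pi = circleMap 0 ρ (-Real.pi) := by
  have := periodic_circleMap 0 ρ (-Real.pi)
  rw [← this]; congr 1; ring

/-- Integration by parts for Laurent coefficients on a circle. -/
lemma integral_circle_deriv {ρ : ℝ} (hρ : 0 < ρ) (n : ℕ) {g g' : ℂ → ℂ}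
    (hd : ∀ θ : ℝ, HasDerivAt g (g' (circleMap 0 ρ θ)) (circleMap 0 ρ θ))
    (hg' : Continuous fun θ : ℝ => g' (circleMap 0 ρ θ)) :
    ∫ θ in (-Real.pi)..Real.pi, g' (circleMap 0 ρ θ) * (circleMap 0 ρ θ ^ n)⁻¹ =
      (n + 1) * ∫ θ in (-Real.pi)..Real.pi,
        g (circleMap 0 ρ θ) * (circleMap 0 ρ θ ^ (n + 1))⁻¹ := by
  have hne : ∀ θ : ℝ, circleMap 0 ρ θ ≠ 0 := fun θ => circleMap_ne_center hρ.ne'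
  have hcm := continuous_circleMap 0 ρ
  have hg : Continuous fun θ : ℝ => g (circleMap 0 ρ θ) := by
    refine continuous_iff_continuousAt.2 fun θ => ?_
    exact ContinuousAt.comp (f := circleMap 0 ρ) (hd θ).continuousAt hcm.continuousAt
  have hinv : ∀ k : ℕ, Continuous fun θ : ℝ => (circleMap 0 ρ θ ^ k)⁻¹ := fun k =>
    (hcm.pow k).inv₀ fun θ => pow_ne_zero k (hne θ)
  -- The function g(x) x^{-(n+1)} is periodic in θ, so the integral of its θ-derivative over a full
  -- turn vanishes; this is the claimed identity up to the factor i.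
  have hu : ∀ θ : ℝ, HasDerivAt
      (fun θ : ℝ => g (circleMap 0 ρ θ) * (circleMap 0 ρ θ ^ (n + 1))⁻¹)
      (Complex.I * (g' (circleMap 0 ρ θ) * (circleMap 0 ρ θ ^ n)⁻¹
        - (n + 1) * (g (circleMap 0 ρ θ) * (circleMap 0 ρ θ ^ (n + 1))⁻¹))) θ := by
    intro θ
    have h1 := hasDerivAt_circleMap 0 ρ θ
    have h2 := (hd θ).comp θ h1
    have h3 := (h1.pow (n + 1)).inv (pow_ne_zero (n + 1) (hne θ))
    refine (h2.mul h3).congr_deriv ?_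
    have := hne θ
    simp only [Pi.inv_apply, Pi.pow_apply, Function.comp_apply, Nat.cast_add, Nat.cast_one,
      Nat.add_sub_cancel]
    field_simp
    ring
  have hcont : Continuous fun θ : ℝ => Complex.I * (g' (circleMap 0 ρ θ) * (circleMap 0 ρ θ ^ n)⁻¹
        - (n + 1) * (g (circleMap 0 ρ θ) * (circleMap 0 ρ θ ^ (n + 1))⁻¹)) :=
    continuous_const.mul ((hg'.mul (hinv n)).sub (continuous_const.mul (hg.mul (hinv (n + 1)))))
  have hc1 : Continuous fun θ : ℝ => g' (circleMap 0 ρ θ) * (circleMap 0 ρ θ ^ n)⁻¹ :=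
    hg'.mul (hinv n)
  have hc2 : Continuous fun θ : ℝ =>
      (n + 1 : ℂ) * (g (circleMap 0 ρ θ) * (circleMap 0 ρ θ ^ (n + 1))⁻¹) :=
    continuous_const.mul (hg.mul (hinv (n + 1)))
  have hint := intervalIntegral.integral_eq_sub_of_hasDerivAt (a := -Real.pi) (b := Real.pi)
    (fun θ _ => hu θ) (hcont.intervalIntegrable _ _)
  rw [circleMap_pi_eq, sub_self, intervalIntegral.integral_const_mul,
    intervalIntegral.integral_sub (hc1.intervalIntegrable _ _) (hc2.intervalIntegrable _ _),
    intervalIntegral.integral_const_mul] at hint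
  exact sub_eq_zero.1 ((mul_eq_zero.1 hint).resolve_left Complex.I_ne_zero)

lemma integral_circle_eq {ρ : ℝ} (hρ : 0 < ρ) {g : ℂ → ℂ}
    (hg : DifferentiableOn ℂ g (Metric.closedBall 0 ρ)) :
    ∫ θ in (-Real.pi)..Real.pi, g (circleMap 0 ρ θ) = 2 * Real.pi * g 0 := by
  have h1 : DiffContOnCl ℂ g (Metric.ball 0 |ρ|) := by
    rw [abs_of_pos hρ]
    exact hg.diffContOnCl_ball subset_rfl
  have h2 := h1.circleAverage
  have hper : Function.Periodic (fun θ : ℝ => g (circleMap 0 ρ θ)) (2 * Real.pi) := fun θ => by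
    simp only [periodic_circleMap 0 ρ θ]
  have h3 := hper.intervalIntegral_add_eq (-Real.pi) 0
  rw [zero_add, show -Real.pi + 2 * Real.pi = Real.pi by ring] at h3
  rw [h3, ← h2, Real.circleAverage_def, Complex.real_smul]
  push_cast
  rw [mul_inv_cancel_left₀ (by simp [Real.pi_ne_zero])]

/-- Induction on n through integration by parts. On the axes x = 0 and y = 0 `genFun` is a pure
exponential, so this supplies the initial values of the recursion. -/
lemma integral_circle_exp {ρ : ℝ} (hρ : 0 < ρ) (a : ℂ) (n : ℕ) :
    ∫ θ in (-Real.pi)..Real.pi,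
      Complex.exp (a * circleMap 0 ρ θ) * (circleMap 0 ρ θ ^ n)⁻¹ =
      2 * Real.pi * (a ^ n / n !) := by
  induction n with
  | zero =>
    have := integral_circle_eq hρ (g := fun x => Complex.exp (a * x)) (by fun_prop)
    simpa using this
  | succ n ih =>
    have h := integral_circle_deriv hρ n (g := fun x => Complex.exp (a * x))
      (g' := fun x => a * Complex.exp (a * x))
      (fun θ => by simpa [mul_comm] using ((hasDerivAt_id (circleMap 0 ρ θ)).const_mul a).cexp)
      (by fun_prop)
    simp_rw [mul_assoc] at h
    rw [intervalIntegral.integral_const_mul, ih] at h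
    have hn : (n + 1 : ℂ) ≠ 0 := by exact_mod_cast n.succ_ne_zero
    rw [← mul_right_inj' hn, ← h, Nat.factorial_succ]
    push_cast
    field_simp
    ring

end TorusCoefficients

/-! ### The correlation function as a double Cauchy integral -/

section CorrelationFormula

/-- The integrand of the Cauchy formula for the coefficient of `x ^ n y ^ m` in `genFun`, on the
torus with radii `ρ`, `σ`. -/
noncomputable def torusIntegrand (c ρ σ : ℝ) (n m : ℕ) (s t : ℝ) (p : ℝ × ℝ) : ℂ :=
  genFun c s t (circleMap 0 ρ p.2) (circleMap 0 σ p.1) * (circleMap 0 ρ p.2 ^ n)⁻¹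
    * (circleMap 0 σ p.1 ^ m)⁻¹

/-- The coefficient of `x ^ n y ^ m` in `genFun`, as a Cauchy integral. -/
noncomputable def torusCoeff (c ρ σ : ℝ) (n m : ℕ) (s t : ℝ) : ℂ :=
  ((2 * Real.pi : ℂ) ^ 2)⁻¹ * ∫ p in angleSquare, torusIntegrand c ρ σ n m s t p

/-- Admissible radii for the Cauchy integrals of `genFun`. -/
structure TorusRadii (ρ σ : ℝ) : Prop where
  left_pos : 0 < ρ
  right_pos : 0 < σ
  mul_lt_one : ρ * σ < 1

variable {c ρ σ : ℝ}

lemma norm_circleMap_zero_le (hρ : 0 < ρ) (θ : ℝ) : ‖circleMap 0 ρ θ‖ ≤ ρ := by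
  rw [norm_circleMap_zero, abs_of_pos hρ]

namespace TorusRadii

lemma one_sub_mul_ne_zero (h : TorusRadii ρ σ) {x y : ℂ}
    (hx : ‖x‖ ≤ ρ) (hy : ‖y‖ ≤ σ) : 1 - x * y ≠ 0 := by
  intro h0
  have h1 : x * y = 1 := (sub_eq_zero.1 h0).symm
  have h2 : ‖x‖ * ‖y‖ = 1 := by rw [← norm_mul, h1, norm_one]
  have h3 : ‖x‖ * ‖y‖ ≤ ρ * σ := mul_le_mul hx hy (norm_nonneg _) h.left_pos.le
  linarith [h.mul_lt_one]

lemma circle_ne (h : TorusRadii ρ σ) (θ η : ℝ) :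
    1 - circleMap 0 ρ θ * circleMap 0 σ η ≠ 0 :=
  h.one_sub_mul_ne_zero (norm_circleMap_zero_le h.left_pos _) (norm_circleMap_zero_le h.right_pos _)

lemma left_ne (h : TorusRadii ρ σ) (θ : ℝ) : circleMap 0 ρ θ ≠ 0 :=
  circleMap_ne_center h.left_pos.ne'

lemma right_ne (h : TorusRadii ρ σ) (θ : ℝ) : circleMap 0 σ θ ≠ 0 :=
  circleMap_ne_center h.right_pos.ne'

variable {Z : Type*} [TopologicalSpace Z] {f g : Z → ℝ} {p : Z → ℝ × ℝ}

lemma continuous_genFun (h : TorusRadii ρ σ) (hf : Continuous f) (hg : Continuous g)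
    (hp : Continuous p) : Continuous fun z =>
    genFun c (f z) (g z) (circleMap 0 ρ (p z).2) (circleMap 0 σ (p z).1) := by
  unfold genFun
  have h1 : ∀ z, 1 - circleMap 0 ρ (p z).2 * circleMap 0 σ (p z).1 ≠ 0 :=
    fun q => h.circle_ne _ _
  have h2 : ∀ z, (1 - circleMap 0 ρ (p z).2 * circleMap 0 σ (p z).1) ^ 3 ≠ 0 :=
    fun q => pow_ne_zero 3 (h1 q)
  fun_prop (disch := assumption)

lemma continuous_torusIntegrand (h : TorusRadii ρ σ) (n m : ℕ) (hf : Continuous f)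
    (hg : Continuous g) (hp : Continuous p) :
    Continuous fun z => torusIntegrand c ρ σ n m (f z) (g z) (p z) := by
  unfold torusIntegrand
  have h1 := h.continuous_genFun (c := c) hf hg hp
  have h2 : ∀ z, circleMap 0 ρ (p z).2 ^ n ≠ 0 := fun q => pow_ne_zero n (h.left_ne _)
  have h3 : ∀ z, circleMap 0 σ (p z).1 ^ m ≠ 0 := fun q => pow_ne_zero m (h.right_ne _)
  fun_prop (disch := assumption)

lemma continuous_dlog (h : TorusRadii ρ σ) (hf : Continuous f) (hp : Continuous p) :
    Continuous fun z => genFunDlog (f z) (circleMap 0 ρ (p z).2) (circleMap 0 σ (p z).1) := by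
  unfold genFunDlog
  have h1 : ∀ z, 1 - circleMap 0 ρ (p z).2 * circleMap 0 σ (p z).1 ≠ 0 :=
    fun q => h.circle_ne _ _
  fun_prop (disch := assumption)

lemma continuous_quot (h : TorusRadii ρ σ) (hp : Continuous p) : Continuous fun z =>
    circleMap 0 σ (p z).1 / (1 - circleMap 0 ρ (p z).2 * circleMap 0 σ (p z).1) := by
  have h1 : ∀ z, 1 - circleMap 0 ρ (p z).2 * circleMap 0 σ (p z).1 ≠ 0 :=
    fun q => h.circle_ne _ _
  fun_prop (disch := assumption)

/-- The integrand with its first derivative in `s`. -/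
lemma hasDerivAt_integral_left (h : TorusRadii ρ σ) (n m : ℕ) (s t : ℝ) :
    HasDerivAt (fun s => ∫ p in angleSquare, torusIntegrand c ρ σ n m s t p)
      (∫ p in angleSquare, torusIntegrand c ρ σ n m s t p *
        genFunDlog t (circleMap 0 ρ p.2) (circleMap 0 σ p.1)) s := by
  refine hasDerivAt_setIntegral_of_continuous isCompact_angleSquare
    (G := fun s p => torusIntegrand c ρ σ n m s t p)
    (G' := fun s p => torusIntegrand c ρ σ n m s t p *
      genFunDlog t (circleMap 0 ρ p.2) (circleMap 0 σ p.1))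
    (fun s => h.continuous_torusIntegrand n m continuous_const continuous_const continuous_id)
    ?_ ?_ s
  · exact (h.continuous_torusIntegrand n m continuous_fst continuous_const continuous_snd).mul
      (h.continuous_dlog continuous_const continuous_snd)
  · intro s p
    refine (((hasDerivAt_genFun_left c s t _ _).mul_const _).mul_const _).congr_deriv ?_
    rw [torusIntegrand]; ring

lemma hasDerivAt_integral_right (h : TorusRadii ρ σ) (n m : ℕ) (s t : ℝ) :
    HasDerivAt (fun t => ∫ p in angleSquare, torusIntegrand c ρ σ n m s t p)
      (∫ p in angleSquare, torusIntegrand c ρ σ n m s t p *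
        genFunDlog s (circleMap 0 ρ p.2) (circleMap 0 σ p.1)) t := by
  have hcomm : ∀ s t p, torusIntegrand c ρ σ n m s t p = torusIntegrand c ρ σ n m t s p :=
    fun s t p => by rw [torusIntegrand, genFun_comm, torusIntegrand]
  simp_rw [hcomm s]
  exact h.hasDerivAt_integral_left n m t s

lemma hasDerivAt_integral_mixed (h : TorusRadii ρ σ) (n m : ℕ) (s t : ℝ) :
    HasDerivAt (fun t => ∫ p in angleSquare, torusIntegrand c ρ σ n m s t p *
        genFunDlog t (circleMap 0 ρ p.2) (circleMap 0 σ p.1))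
      (∫ p in angleSquare, torusIntegrand c ρ σ n m s t p *
        (genFunDlog s (circleMap 0 ρ p.2) (circleMap 0 σ p.1) *
        genFunDlog t (circleMap 0 ρ p.2) (circleMap 0 σ p.1) +
        circleMap 0 σ p.1 / (1 - circleMap 0 ρ p.2 * circleMap 0 σ p.1))) t := by
  refine hasDerivAt_setIntegral_of_continuous isCompact_angleSquare
    (G := fun t p => torusIntegrand c ρ σ n m s t p *
        genFunDlog t (circleMap 0 ρ p.2) (circleMap 0 σ p.1))
    (G' := fun t p => torusIntegrand c ρ σ n m s t p *
        (genFunDlog s (circleMap 0 ρ p.2) (circleMap 0 σ p.1) *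
        genFunDlog t (circleMap 0 ρ p.2) (circleMap 0 σ p.1) +
        circleMap 0 σ p.1 / (1 - circleMap 0 ρ p.2 * circleMap 0 σ p.1)))
    (fun t => (h.continuous_torusIntegrand n m continuous_const continuous_const
      continuous_id).mul (h.continuous_dlog continuous_const continuous_id)) ?_ ?_ t
  · exact (h.continuous_torusIntegrand n m continuous_const continuous_fst continuous_snd).mul
      (((h.continuous_dlog continuous_const continuous_snd).mul
        (h.continuous_dlog continuous_fst continuous_snd)).add
        (h.continuous_quot continuous_snd))
  · intro t p
    refine ((((hasDerivAt_genFun_right c s t _ _).mul_const _).mul_const _).mul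
      (hasDerivAt_genFunDlog t _ _)).congr_deriv ?_
    simp only [torusIntegrand]; ring

/-- For n = 0 the integrand is holomorphic in x on the closed disc, so the mean value property sets
x = 0 and leaves exp(s t y). -/
lemma torusCoeff_zero_left (h : TorusRadii ρ σ) (m : ℕ) (s t : ℝ) :
    torusCoeff c ρ σ 0 m s t = (s * t) ^ m / m ! := by
  have hc : Continuous fun p => torusIntegrand c ρ σ 0 m s t p :=
    h.continuous_torusIntegrand 0 m continuous_const continuous_const continuous_id
  have hin : ∀ η : ℝ, ∫ θ in (-Real.pi)..Real.pi, torusIntegrand c ρ σ 0 m s t (η, θ) =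
      2 * Real.pi * (Complex.exp ((s * t) * circleMap 0 σ η) * (circleMap 0 σ η ^ m)⁻¹) := by
    intro η
    have := integral_circle_eq h.left_pos (g := fun x => genFun c s t x (circleMap 0 σ η) *
      (circleMap 0 σ η ^ m)⁻¹) (fun x hx => ?_)
    · simpa [torusIntegrand, genFun] using this
    · refine ((hasDerivAt_genFun_x c s t (h.one_sub_mul_ne_zero (by simpa using hx)
        (norm_circleMap_zero_le h.right_pos η))).differentiableAt.mul_const _
        ).differentiableWithinAt
  rw [torusCoeff, integral_angleSquare hc]
  simp_rw [hin]
  rw [intervalIntegral.integral_const_mul, integral_circle_exp h.right_pos]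
  have : (Real.pi : ℂ) ≠ 0 := by simp [Real.pi_ne_zero]
  field_simp

lemma torusCoeff_zero_right (h : TorusRadii ρ σ) (n : ℕ) (s t : ℝ) :
    torusCoeff c ρ σ n 0 s t = 1 / n ! := by
  have hc : Continuous fun p => torusIntegrand c ρ σ n 0 s t p :=
    h.continuous_torusIntegrand n 0 continuous_const continuous_const continuous_id
  have hin : ∀ θ : ℝ, ∫ η in (-Real.pi)..Real.pi, torusIntegrand c ρ σ n 0 s t (η, θ) =
      2 * Real.pi * (Complex.exp (1 * circleMap 0 ρ θ) * (circleMap 0 ρ θ ^ n)⁻¹) := by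
    intro θ
    have := integral_circle_eq h.right_pos (g := fun y => genFun c s t (circleMap 0 ρ θ) y *
      (circleMap 0 ρ θ ^ n)⁻¹) (fun y hy => ?_)
    · simpa [torusIntegrand, genFun] using this
    · have hne := h.one_sub_mul_ne_zero (norm_circleMap_zero_le h.left_pos θ)
        (show ‖y‖ ≤ σ by simpa using hy)
      have hne3 := pow_ne_zero 3 hne
      unfold genFun
      have : DifferentiableAt ℂ (fun y => Complex.exp ((circleMap 0 ρ θ + s * t * y -
          (s + t) * (circleMap 0 ρ θ * y)) / (1 - circleMap 0 ρ θ * y) +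
          c * (circleMap 0 ρ θ * y)) / (1 - circleMap 0 ρ θ * y) ^ 3 *
          (circleMap 0 ρ θ ^ n)⁻¹) y := by
        fun_prop (disch := assumption)
      exact this.differentiableWithinAt
  rw [torusCoeff, integral_angleSquare_swap hc]
  simp_rw [hin]
  rw [intervalIntegral.integral_const_mul, integral_circle_exp h.left_pos]
  have : (Real.pi : ℂ) ≠ 0 := by simp [Real.pi_ne_zero]
  field_simp
  simp

lemma continuous_dlogX (h : TorusRadii ρ σ) (hf : Continuous f) (hg : Continuous g)
    (hp : Continuous p) : Continuous fun z =>
    genFunDlogX c (f z) (g z) (circleMap 0 ρ (p z).2) (circleMap 0 σ (p z).1) := by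
  unfold genFunDlogX
  have h1 := h.continuous_dlog hf hp
  have h2 := h.continuous_dlog hg hp
  have h3 := h.continuous_quot hp
  fun_prop

/-- Integration by parts in the first variable. -/
lemma integral_deriv_eq (h : TorusRadii ρ σ) (n m : ℕ) (s t : ℝ) :
    ∫ p in angleSquare, torusIntegrand c ρ σ n m s t p *
      genFunDlogX c s t (circleMap 0 ρ p.2) (circleMap 0 σ p.1) =
    (n + 1) * ∫ p in angleSquare, torusIntegrand c ρ σ (n + 1) m s t p := by
  have hI : ∀ n, Continuous fun p => torusIntegrand c ρ σ n m s t p := fun n =>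
    h.continuous_torusIntegrand n m continuous_const continuous_const continuous_id
  have hIfac : Continuous fun p => torusIntegrand c ρ σ n m s t p *
      genFunDlogX c s t (circleMap 0 ρ p.2) (circleMap 0 σ p.1) :=
    (hI n).fun_mul (h.continuous_dlogX continuous_const continuous_const continuous_id)
  have inner : ∀ η : ℝ, ∫ θ in (-Real.pi)..Real.pi, torusIntegrand c ρ σ n m s t (η, θ) *
      genFunDlogX c s t (circleMap 0 ρ θ) (circleMap 0 σ η) =
      (n + 1) * ∫ θ in (-Real.pi)..Real.pi, torusIntegrand c ρ σ (n + 1) m s t (η, θ) := by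
    intro η
    have hslice : Continuous fun θ : ℝ => (η, θ) := by fun_prop
    have hcG : Continuous fun θ : ℝ => genFun c s t (circleMap 0 ρ θ) (circleMap 0 σ η) :=
      h.continuous_genFun (c := c) (f := fun _ => s) (g := fun _ => t) (p := fun θ => (η, θ))
        continuous_const continuous_const hslice
    have hcX : Continuous fun θ : ℝ => genFunDlogX c s t (circleMap 0 ρ θ) (circleMap 0 σ η) :=
      h.continuous_dlogX (c := c) (f := fun _ => s) (g := fun _ => t) (p := fun θ => (η, θ))
        continuous_const continuous_const hslice
    have hcont : Continuous fun θ : ℝ => genFun c s t (circleMap 0 ρ θ) (circleMap 0 σ η) *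
        genFunDlogX c s t (circleMap 0 ρ θ) (circleMap 0 σ η) :=
      hcG.fun_mul hcX
    have hder : ∀ θ : ℝ, HasDerivAt (fun x => genFun c s t x (circleMap 0 σ η))
        (genFun c s t (circleMap 0 ρ θ) (circleMap 0 σ η) *
        genFunDlogX c s t (circleMap 0 ρ θ) (circleMap 0 σ η)) (circleMap 0 ρ θ) :=
      fun θ => hasDerivAt_genFun_x c s t (h.circle_ne θ η)
    have key := integral_circle_deriv h.left_pos n
      (g := fun x => genFun c s t x (circleMap 0 σ η))
      (g' := fun x => genFun c s t x (circleMap 0 σ η) * genFunDlogX c s t x (circleMap 0 σ η))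
      hder hcont
    have e1 : ∀ θ : ℝ, torusIntegrand c ρ σ n m s t (η, θ) *
        genFunDlogX c s t (circleMap 0 ρ θ) (circleMap 0 σ η) =
        (genFun c s t (circleMap 0 ρ θ) (circleMap 0 σ η) *
        genFunDlogX c s t (circleMap 0 ρ θ) (circleMap 0 σ η) * (circleMap 0 ρ θ ^ n)⁻¹) *
        (circleMap 0 σ η ^ m)⁻¹ := fun θ => by rw [torusIntegrand]; ring
    simp_rw [e1]
    rw [intervalIntegral.integral_mul_const, key, mul_assoc, ← intervalIntegral.integral_mul_const]
    rfl
  rw [integral_angleSquare hIfac, integral_angleSquare (hI (n + 1)),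
    ← intervalIntegral.integral_const_mul]
  exact intervalIntegral.integral_congr fun η _ => inner η

end TorusRadii

lemma integral_linear_combination {α : Type*} [MeasurableSpace α] {ν : Measure α}
    {f₀ f₁ f₂ f₃ f₄ : α → ℂ} (h₀ : Integrable f₀ ν) (h₁ : Integrable f₁ ν) (h₂ : Integrable f₂ ν)
    (h₃ : Integrable f₃ ν) (h₄ : Integrable f₄ ν) (k l : ℂ) :
    ∫ a, (f₀ a - f₁ a - f₂ a + f₃ a + k * (f₂ a - f₁ a) + l * f₄ a) ∂ν =
      (∫ a, f₀ a ∂ν) - (∫ a, f₁ a ∂ν) - (∫ a, f₂ a ∂ν) + (∫ a, f₃ a ∂ν)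
        + k * ((∫ a, f₂ a ∂ν) - ∫ a, f₁ a ∂ν) + l * ∫ a, f₄ a ∂ν := by
  rw [integral_add (by fun_prop) (by fun_prop), integral_add (by fun_prop) (by fun_prop),
    integral_add (by fun_prop) (by fun_prop), integral_sub (by fun_prop) (by fun_prop),
    integral_sub (by fun_prop) (by fun_prop), integral_const_mul, integral_const_mul,
    integral_sub (by fun_prop) (by fun_prop)]

variable {Q : Measure ℝ} [IsProbabilityMeasure Q] {b : ℝ}

/-- The correlation function of the product law as a Cauchy integral. -/
theorem gramCorr_eq_torusCoeff (hQ : HasStandingMoments Q b) (h : TorusRadii ρ σ) (n m : ℕ)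
    (s t : ℝ) : (gramCorr Q n m s t : ℂ) = n ! * m ! * torusCoeff (b - 3) ρ σ n m s t := by
  induction n generalizing m s t with
  | zero =>
    rw [gramCorr_zero_left, h.torusCoeff_zero_left]
    have : (m ! : ℂ) ≠ 0 := by exact_mod_cast m.factorial_ne_zero
    push_cast
    field_simp
    simp
  | succ n ih =>
  -- The recursion in n removes a column, so the case without columns is a boundary value of its
  -- own.
  rcases m with _ | m
  · rw [gramCorr_zero_right, h.torusCoeff_zero_right]
    have : ((n + 1)! : ℂ) ≠ 0 := by exact_mod_cast (n + 1).factorial_ne_zero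
    push_cast
    field_simp
    simp
  set K : ℂ := n ! * (m + 1)! * ((2 * Real.pi : ℂ) ^ 2)⁻¹ with hK
  have e00 : ∀ s t, (gramCorr Q n (m + 1) s t : ℂ) =
      K * ∫ p in angleSquare, torusIntegrand (b - 3) ρ σ n (m + 1) s t p := fun s t => by
    rw [ih, torusCoeff, hK]; ring
  have hds : ∀ s t, HasDerivAt (fun s => gramCorr Q n (m + 1) s t)
      (∫ X, gramDet' X s * gramDet X t ∂(matrixLaw Q n (m + 1))) s := fun s t =>
    hasDerivAt_integral_gramDet_mul hQ (entryDominated_gramDet t) s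
  have hdt : ∀ s t, HasDerivAt (fun t => gramCorr Q n (m + 1) s t)
      (∫ X, gramDet X s * gramDet' X t ∂(matrixLaw Q n (m + 1))) t := fun s t => by
    have := hasDerivAt_integral_gramDet_mul (n := n) (m := m + 1) hQ (entryDominated_gramDet s) t
    simp_rw [mul_comm _ (gramDet _ s)] at this
    exact this
  have hdst : ∀ s t, HasDerivAt
      (fun t => ∫ X, gramDet' X s * gramDet X t ∂(matrixLaw Q n (m + 1)))
      (∫ X, gramDet' X s * gramDet' X t ∂(matrixLaw Q n (m + 1))) t := fun s t => by
    have := hasDerivAt_integral_gramDet_mul (n := n) (m := m + 1) hQ (entryDominated_gramDet' s) t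
    simp_rw [mul_comm _ (gramDet' _ s)] at this
    exact this
  -- The induction hypothesis holds for all s and t, so it may be differentiated: both sides of
  -- `e00` have derivatives under their integrals, and derivatives are unique.
  have e10 : ∀ s t, ((∫ X, gramDet' X s * gramDet X t ∂(matrixLaw Q n (m + 1)) : ℝ) : ℂ) =
      K * ∫ p in angleSquare, torusIntegrand (b - 3) ρ σ n (m + 1) s t p *
        genFunDlog t (circleMap 0 ρ p.2) (circleMap 0 σ p.1) := fun s t => by
    have h1 := (hds s t).ofReal_comp
    simp_rw [e00] at h1
    exact h1.unique ((h.hasDerivAt_integral_left n (m + 1) s t).const_mul K)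
  have e01 : ∀ s t, ((∫ X, gramDet X s * gramDet' X t ∂(matrixLaw Q n (m + 1)) : ℝ) : ℂ) =
      K * ∫ p in angleSquare, torusIntegrand (b - 3) ρ σ n (m + 1) s t p *
        genFunDlog s (circleMap 0 ρ p.2) (circleMap 0 σ p.1) := fun s t => by
    have h1 := (hdt s t).ofReal_comp
    simp_rw [e00] at h1
    exact h1.unique ((h.hasDerivAt_integral_right n (m + 1) s t).const_mul K)
  have e11 : ∀ s t, ((∫ X, gramDet' X s * gramDet' X t ∂(matrixLaw Q n (m + 1)) : ℝ) : ℂ) =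
      K * ∫ p in angleSquare, torusIntegrand (b - 3) ρ σ n (m + 1) s t p *
        (genFunDlog s (circleMap 0 ρ p.2) (circleMap 0 σ p.1) *
        genFunDlog t (circleMap 0 ρ p.2) (circleMap 0 σ p.1) +
        circleMap 0 σ p.1 / (1 - circleMap 0 ρ p.2 * circleMap 0 σ p.1)) := fun s t => by
    have h1 := (hdst s t).ofReal_comp
    simp_rw [e10] at h1
    exact h1.unique ((h.hasDerivAt_integral_mixed n (m + 1) s t).const_mul K)
  -- A factor y lowers the extracted power of y by one, and m + 1 completes the factorial.
  have elow : ∀ s t, ((m + 1 : ℂ) * gramCorr Q n m s t) =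
      K * ∫ p in angleSquare, torusIntegrand (b - 3) ρ σ n (m + 1) s t p *
        circleMap 0 σ p.1 := fun s t => by
    rw [ih, torusCoeff, hK, Nat.factorial_succ]
    have : ∀ p, torusIntegrand (b - 3) ρ σ n (m + 1) s t p * circleMap 0 σ p.1 =
        torusIntegrand (b - 3) ρ σ n m s t p := fun p => by
      have := h.right_ne p.1
      rw [torusIntegrand, torusIntegrand]
      field_simp
      ring
    simp_rw [this]
    push_cast
    ring
  have hne : ∀ s t, s ≠ t → (gramCorr Q (n + 1) (m + 1) s t : ℂ) =
      (n + 1)! * (m + 1)! * torusCoeff (b - 3) ρ σ (n + 1) (m + 1) s t := by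
    intro s t hst
    have hst' : (s : ℂ) - t ≠ 0 := sub_ne_zero.2 (by exact_mod_cast hst)
    have hcD : ∀ s, Continuous fun p : ℝ × ℝ =>
        genFunDlog s (circleMap 0 ρ p.2) (circleMap 0 σ p.1) := fun s =>
      h.continuous_dlog continuous_const continuous_id
    have hcI : Continuous fun p => torusIntegrand (b - 3) ρ σ n (m + 1) s t p :=
      h.continuous_torusIntegrand n (m + 1) continuous_const continuous_const continuous_id
    have hcs := hcD s
    have hct := hcD t
    have hcq : Continuous fun p : ℝ × ℝ => circleMap 0 σ p.1 /
        (1 - circleMap 0 ρ p.2 * circleMap 0 σ p.1) := h.continuous_quot continuous_id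
    have hint : ∀ {f : ℝ × ℝ → ℂ}, Continuous f → Integrable f (volume.restrict angleSquare) :=
      fun hf => hf.continuousOn.integrableOn_compact isCompact_angleSquare
    rw [gramCorr_succ_succ hQ n m hst]
    push_cast
    rw [e00, e10, e01, e11, elow]
    have hparts := h.integral_deriv_eq (c := b - 3) n (m + 1) s t
    have hsplit : ∫ p in angleSquare, torusIntegrand (b - 3) ρ σ n (m + 1) s t p *
      genFunDlogX (b - 3) s t (circleMap 0 ρ p.2) (circleMap 0 σ p.1) =
      (∫ p in angleSquare, torusIntegrand (b - 3) ρ σ n (m + 1) s t p)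
      - (∫ p in angleSquare, torusIntegrand (b - 3) ρ σ n (m + 1) s t p *
        genFunDlog t (circleMap 0 ρ p.2) (circleMap 0 σ p.1))
      - (∫ p in angleSquare, torusIntegrand (b - 3) ρ σ n (m + 1) s t p *
        genFunDlog s (circleMap 0 ρ p.2) (circleMap 0 σ p.1))
      + (∫ p in angleSquare, torusIntegrand (b - 3) ρ σ n (m + 1) s t p *
        (genFunDlog s (circleMap 0 ρ p.2) (circleMap 0 σ p.1) *
        genFunDlog t (circleMap 0 ρ p.2) (circleMap 0 σ p.1) +
        circleMap 0 σ p.1 / (1 - circleMap 0 ρ p.2 * circleMap 0 σ p.1)))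
      + 2 / ((s : ℂ) - t) * ((∫ p in angleSquare, torusIntegrand (b - 3) ρ σ n (m + 1) s t p *
        genFunDlog s (circleMap 0 ρ p.2) (circleMap 0 σ p.1))
        - (∫ p in angleSquare, torusIntegrand (b - 3) ρ σ n (m + 1) s t p *
        genFunDlog t (circleMap 0 ρ p.2) (circleMap 0 σ p.1)))
      + ((b - 3 : ℝ) : ℂ) * ∫ p in angleSquare, torusIntegrand (b - 3) ρ σ n (m + 1) s t p *
        circleMap 0 σ p.1 := by
      refine Eq.trans ?_ (integral_linear_combination (hint hcI)
        (hint (hcI.fun_mul hct)) (hint (hcI.fun_mul hcs))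
        (hint (hcI.fun_mul ((hcs.fun_mul hct).fun_add hcq)))
        (hint (hcI.fun_mul (by fun_prop : Continuous fun p : ℝ × ℝ => circleMap 0 σ p.1)))
        _ _)
      refine integral_congr_ae (ae_of_all _ fun p => ?_)
      have hp := h.circle_ne p.2 p.1
      -- This cancels the divided difference and gives 2y/(1 - xy). With one further y/(1 - xy) from
      -- the mixed derivative, it accounts for the exponent 3 in `genFun`.
      have hD : genFunDlog s (circleMap 0 ρ p.2) (circleMap 0 σ p.1) -
          genFunDlog t (circleMap 0 ρ p.2) (circleMap 0 σ p.1) =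
          (s - t) * (circleMap 0 σ p.1 / (1 - circleMap 0 ρ p.2 * circleMap 0 σ p.1)) := by
        simp only [genFunDlog]; field_simp; ring
      dsimp only
      rw [← mul_sub, hD, genFunDlogX]
      field_simp
      ring
    rw [hsplit] at hparts
    rw [torusCoeff, Nat.factorial_succ]
    have hfin := congrArg (fun z => K * z) hparts
    simp only [hK] at hfin ⊢
    push_cast at hfin ⊢
    linear_combination hfin
  rcases eq_or_ne s t with rfl | hst
  -- On the diagonal both sides are limits as t → s, by continuity in t.
  · have c1 : ContinuousAt (fun t => (gramCorr Q (n + 1) (m + 1) s t : ℂ)) s := by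
      have := hasDerivAt_integral_gramDet_mul (n := n + 1) (m := m + 1) hQ
        (entryDominated_gramDet s) s
      simp_rw [mul_comm _ (gramDet _ s)] at this
      exact this.continuousAt.ofReal
    have c2 : ContinuousAt (fun t => (n + 1)! * (m + 1)! *
        torusCoeff (b - 3) ρ σ (n + 1) (m + 1) s t) s :=
      (((h.hasDerivAt_integral_right (n + 1) (m + 1) s s).const_mul _).const_mul _).continuousAt
    refine tendsto_nhds_unique ((c1.tendsto.mono_left (nhdsWithin_le_nhds (s := {s}ᶜ))).congr' ?_)
      (c2.tendsto.mono_left nhdsWithin_le_nhds)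
    filter_upwards [self_mem_nhdsWithin] with t ht
    exact hne s t (Ne.symm ht)
  · exact hne s t hst

end CorrelationFormula

/-! ### Half-sum and half-difference angles on the scale 1/N -/

section BulkCoordinates

lemma Function.Periodic.integral_shift {f : ℝ → ℂ} (hf : Function.Periodic f (2 * Real.pi))
    (a : ℝ) : ∫ x in (-Real.pi)..Real.pi, f (a + x) = ∫ x in (-Real.pi)..Real.pi, f x := by
  rw [intervalIntegral.integral_comp_add_left]
  have := hf.intervalIntegral_add_eq (a + -Real.pi) (-Real.pi)
  convert this using 2 <;> ring

/-- The square with side `2 π N`. -/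
def scaledSquare (N : ℝ) : Set (ℝ × ℝ) :=
  Set.Icc (-(Real.pi * N)) (Real.pi * N) ×ˢ Set.Icc (-(Real.pi * N)) (Real.pi * N)

lemma integral_scaledSquare {G : ℝ × ℝ → ℂ} (hG : Continuous G) {N : ℝ} (hN : 0 < N) :
    ∫ p in scaledSquare N, G p = ∫ y in (-(Real.pi * N))..(Real.pi * N),
      ∫ τ in (-(Real.pi * N))..(Real.pi * N), G (y, τ) := by
  have hle : -(Real.pi * N) ≤ Real.pi * N := by linarith [mul_pos Real.pi_pos hN]
  rw [scaledSquare, Measure.volume_eq_prod, setIntegral_prod _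
    (hG.continuousOn.integrableOn_compact (isCompact_Icc.prod isCompact_Icc))]
  simp_rw [integral_Icc_eq_integral_Ioc, intervalIntegral.integral_of_le hle]

/-- A doubly periodic integral in rescaled half-sum and half-difference coordinates. -/
lemma integral_angleSquare_eq_scaledSquare {G : ℝ × ℝ → ℂ} (hG : Continuous G)
    (h1 : ∀ θ, Function.Periodic (fun η => G (η, θ)) (2 * Real.pi))
    (h2 : ∀ η, Function.Periodic (fun θ => G (η, θ)) (2 * Real.pi)) {N : ℝ} (hN : 0 < N) :
    ∫ p in angleSquare, G p = ((N : ℂ) ^ 2)⁻¹ * ∫ p in scaledSquare N,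
      G (-p.1 / (2 * N) - p.2 / N, -p.1 / (2 * N) + p.2 / N) := by
  -- The new first variable is u = η + θ; periodicity restores the square after the shear. Later θ
  -- is shifted by u/2 and u is replaced by -y/N.
  have step1 : ∫ p in angleSquare, G p = ∫ p in angleSquare, G (p.1 - p.2, p.2) := by
    rw [integral_angleSquare_swap hG, integral_angleSquare_swap (by fun_prop)]
    refine intervalIntegral.integral_congr fun θ _ => ?_
    have := (h1 θ).integral_shift (-θ)
    simp only [neg_add_eq_sub] at this
    exact this.symm
  have step2 : ∀ u : ℝ, ∫ θ in (-Real.pi)..Real.pi, G (u - θ, θ) =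
      (N : ℂ)⁻¹ * ∫ τ in (-(Real.pi * N))..(Real.pi * N), G (u / 2 - τ / N, u / 2 + τ / N) := by
    intro u
    have hper : Function.Periodic (fun θ => G (u - θ, θ)) (2 * Real.pi) := by
      intro θ
      have e1 := h1 (θ + 2 * Real.pi) (u - (θ + 2 * Real.pi))
      have e2 := h2 (u - θ) θ
      simp only at e1 e2 ⊢
      rw [← e1, ← e2]
      congr 2; ring
    rw [← hper.integral_shift (u / 2)]
    have := intervalIntegral.integral_comp_div (a := -(Real.pi * N)) (b := Real.pi * N)
      (fun τ => G (u - (u / 2 + τ), u / 2 + τ)) hN.ne'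
    rw [neg_div, mul_div_cancel_right₀ _ hN.ne'] at this
    have h3 : ∀ τ : ℝ, u - (u / 2 + τ / N) = u / 2 - τ / N := fun τ => by ring
    simp_rw [h3] at this
    rw [this, Complex.real_smul, inv_mul_cancel_left₀ (by exact_mod_cast hN.ne')]
  have hc2 : Continuous fun p : ℝ × ℝ => G (p.1 - p.2, p.2) := by fun_prop
  have hc3 : Continuous fun p : ℝ × ℝ =>
      G (-p.1 / (2 * N) - p.2 / N, -p.1 / (2 * N) + p.2 / N) := by fun_prop
  rw [step1, integral_angleSquare hc2, integral_scaledSquare hc3 hN]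
  simp_rw [step2]
  rw [intervalIntegral.integral_const_mul]
  have h4 := intervalIntegral.integral_comp_div (a := -(Real.pi * N)) (b := Real.pi * N)
    (fun u => ∫ τ in (-(Real.pi * N))..(Real.pi * N), G (u / 2 - τ / N, u / 2 + τ / N))
    (neg_ne_zero.2 hN.ne')
  rw [neg_div_neg_eq, mul_div_cancel_right₀ _ hN.ne', div_neg, mul_div_cancel_right₀ _ hN.ne',
    intervalIntegral.integral_symm (-Real.pi), smul_neg, neg_smul, neg_neg, Complex.real_smul] at h4
  have h5 : ∀ y τ : ℝ, G (y / -N / 2 - τ / N, y / -N / 2 + τ / N) =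
      G (-y / (2 * N) - τ / N, -y / (2 * N) + τ / N) := fun y τ => by
    congr 2 <;> field_simp
  simp_rw [h5] at h4
  have hNc : (N : ℂ) ≠ 0 := by exact_mod_cast hN.ne'
  rw [h4, pow_two, mul_inv, mul_assoc, inv_mul_cancel_left₀ hNc]

/-- The point `exp (-(1 + i y) / (2 N))` close to `1`. -/
noncomputable def bulkPt (N y : ℝ) : ℂ := Complex.exp (-(1 + y * Complex.I) / (2 * N))

/-- The rescaled integrand in the bulk coordinates. -/
noncomputable def bulkIntegrand (c : ℝ) (α m : ℕ) (N s t : ℝ) (p : ℝ × ℝ) : ℂ :=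
  ((N * (1 - bulkPt N p.1 ^ 2)) ^ 3)⁻¹ *
    Complex.exp (c * bulkPt N p.1 ^ 2
      - (s + t) / 2 * ((1 - bulkPt N p.1) / (1 + bulkPt N p.1))
      - ((s + t) / 2 - √(s * t) * Real.cos (p.2 / N) : ℝ) *
        (2 * bulkPt N p.1 / (1 - bulkPt N p.1 ^ 2))) *
    (bulkPt N p.1 ^ (2 * m + α))⁻¹ * Complex.exp (-(α * (p.2 / N) * Complex.I))

lemma norm_bulkPt (N y : ℝ) : ‖bulkPt N y‖ = Real.exp (-1 / (2 * N)) := by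
  rw [bulkPt, Complex.norm_exp]
  congr 1
  have : (-(1 + y * Complex.I) / (2 * N) : ℂ) = ((-1 / (2 * N) : ℝ) : ℂ) +
      ((-y / (2 * N) : ℝ) : ℂ) * Complex.I := by push_cast; ring
  rw [this, Complex.add_re, Complex.ofReal_re, Complex.re_ofReal_mul, Complex.I_re, mul_zero,
    add_zero]

lemma norm_bulkPt_lt_one {N : ℝ} (hN : 0 < N) (y : ℝ) : ‖bulkPt N y‖ < 1 := by
  rw [norm_bulkPt, Real.exp_lt_one_iff]
  exact div_neg_of_neg_of_pos (by norm_num) (by positivity)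

lemma one_add_ne_zero_of_norm_lt {w : ℂ} (hw : ‖w‖ < 1) : 1 + w ≠ 0 := by
  intro h
  have : w = -1 := by linear_combination h
  simp [this] at hw

lemma one_sub_ne_zero_of_norm_lt {w : ℂ} (hw : ‖w‖ < 1) : 1 - w ≠ 0 := by
  simpa [sub_eq_add_neg] using one_add_ne_zero_of_norm_lt (w := -w) (by simpa using hw)

lemma circleMap_bulk_left {N q : ℝ} (y τ : ℝ) :
    circleMap 0 (q * Real.exp (-1 / (2 * N))) (-y / (2 * N) + τ / N) =
      q * bulkPt N y * Complex.exp (τ / N * Complex.I) := by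
  rw [circleMap, zero_add, bulkPt, Complex.ofReal_mul, Complex.ofReal_exp, mul_assoc, mul_assoc,
    ← Complex.exp_add, ← Complex.exp_add]
  congr 2
  push_cast
  ring

lemma circleMap_bulk_right {N q : ℝ} (y τ : ℝ) :
    circleMap 0 (Real.exp (-1 / (2 * N)) / q) (-y / (2 * N) - τ / N) =
      bulkPt N y / q * (Complex.exp (τ / N * Complex.I))⁻¹ := by
  rw [circleMap, zero_add, bulkPt, Complex.ofReal_div, Complex.ofReal_exp, div_mul_eq_mul_div,
    div_mul_eq_mul_div, ← Complex.exp_neg, ← Complex.exp_add, ← Complex.exp_add]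
  congr 2
  push_cast
  ring

/-- The radii balance x against s t y, so that xy = w² and the linear terms combine to 2 q w
cos(τ/N), with q = √(st). Adding -(s + t)/2 regroups the exponent into multiples of (1 - w)/(1 + w)
and 2w/(1 - w²), both of nonnegative real part on the square. -/
lemma torusIntegrand_bulk {c N s t : ℝ} (hN : 0 < N) (hs : 0 < s) (ht : 0 < t) (α m : ℕ)
    (p : ℝ × ℝ) :
    (√(s * t) : ℂ) ^ α * Complex.exp (-((s + t) / 2)) * ((N : ℂ) ^ 3)⁻¹ *
      torusIntegrand c (√(s * t) * Real.exp (-1 / (2 * N))) (Real.exp (-1 / (2 * N)) / √(s * t))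
      (m + α) m s t (-p.1 / (2 * N) - p.2 / N, -p.1 / (2 * N) + p.2 / N) =
    bulkIntegrand c α m N s t p := by
  have hq : 0 < √(s * t) := Real.sqrt_pos.2 (mul_pos hs ht)
  have hqq : (√(s * t) : ℂ) ^ 2 = s * t := by
    rw [← Complex.ofReal_pow, Real.sq_sqrt (mul_pos hs ht).le, Complex.ofReal_mul]
  rw [torusIntegrand]
  dsimp only
  rw [circleMap_bulk_left, circleMap_bulk_right, bulkIntegrand, genFun]
  set w := bulkPt N p.1 with hw
  set q : ℂ := ((√(s * t) : ℝ) : ℂ) with hqdef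
  set e := Complex.exp (p.2 / N * Complex.I) with he
  have hq0 : q ≠ 0 := by rw [hqdef]; exact_mod_cast hq.ne'
  have he0 : e ≠ 0 := Complex.exp_ne_zero _
  have hw0 : w ≠ 0 := Complex.exp_ne_zero _
  have hN0 : (N : ℂ) ≠ 0 := by exact_mod_cast hN.ne'
  have hw1 : ‖w‖ < 1 := norm_bulkPt_lt_one hN _
  have h1 : 1 + w ≠ 0 := one_add_ne_zero_of_norm_lt hw1
  have h2 : 1 - w ^ 2 ≠ 0 := one_sub_ne_zero_of_norm_lt (by
    rw [norm_pow]; exact pow_lt_one₀ (norm_nonneg _) hw1 two_ne_zero)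
  have hxy : q * w * e * (w / q * e⁻¹) = w ^ 2 := by field_simp
  have hea : Complex.exp (-(α * (p.2 / N) * Complex.I)) = (e ^ α)⁻¹ := by
    rw [he, ← Complex.exp_nat_mul, ← Complex.exp_neg]
    congr 1; ring
  have hcos : ((Real.cos (p.2 / N) : ℝ) : ℂ) = (e + e⁻¹) / 2 := by
    rw [Complex.ofReal_cos, Complex.cos, he, ← Complex.exp_neg]
    push_cast
    ring_nf
  have hexp : Complex.exp (-((s + t) / 2)) * Complex.exp ((q * w * e + s * t * (w / q * e⁻¹)
      - (s + t) * (w ^ 2)) / (1 - w ^ 2) + c * w ^ 2) =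
      Complex.exp (c * w ^ 2 - (s + t) / 2 * ((1 - w) / (1 + w))
      - ((s + t) / 2 - √(s * t) * Real.cos (p.2 / N) : ℝ) * (2 * w / (1 - w ^ 2))) := by
    rw [← Complex.exp_add]
    congr 1
    push_cast
    rw [← hqdef, ← Complex.ofReal_div, ← Complex.ofReal_cos, hcos, ← hqq]
    field_simp
    ring
  rw [hxy, ← hexp, hea]
  have hpow : (((q * w * e) ^ (m + α))⁻¹ * ((w / q * e⁻¹) ^ m)⁻¹) =
      (q ^ α)⁻¹ * (w ^ (2 * m + α))⁻¹ * (e ^ α)⁻¹ := by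
    rw [mul_pow, mul_pow, mul_pow, div_pow, inv_pow]
    field_simp
    ring
  rw [mul_assoc _ _ (((w / q * e⁻¹) ^ m)⁻¹), hpow]
  field_simp

lemma torusRadii_bulk {N s t : ℝ} (hN : 0 < N) (hs : 0 < s) (ht : 0 < t) :
    TorusRadii (√(s * t) * Real.exp (-1 / (2 * N))) (Real.exp (-1 / (2 * N)) / √(s * t)) := by
  have hq : 0 < √(s * t) := Real.sqrt_pos.2 (mul_pos hs ht)
  refine ⟨by positivity, by positivity, ?_⟩
  rw [mul_comm (√(s * t)), mul_assoc, mul_div_cancel₀ _ hq.ne', ← Real.exp_add,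
    Real.exp_lt_one_iff]
  have : -1 / (2 * N) < 0 := div_neg_of_neg_of_pos (by norm_num) (by positivity)
  linarith

/-- The rescaled correlation coefficient as an integral over a growing square. -/
lemma torusCoeff_bulk {c N s t : ℝ} (hN : 0 < N) (hs : 0 < s) (ht : 0 < t) (α m : ℕ) :
    (N : ℂ)⁻¹ * ((√(s * t) : ℂ) ^ α * Complex.exp (-((s + t) / 2))) *
      torusCoeff c (√(s * t) * Real.exp (-1 / (2 * N))) (Real.exp (-1 / (2 * N)) / √(s * t))
        (m + α) m s t =
    ((2 * Real.pi : ℂ) ^ 2)⁻¹ * ∫ p in scaledSquare N, bulkIntegrand c α m N s t p := by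
  have hr := torusRadii_bulk hN hs ht
  have hc : Continuous fun p => torusIntegrand c (√(s * t) * Real.exp (-1 / (2 * N)))
      (Real.exp (-1 / (2 * N)) / √(s * t)) (m + α) m s t p :=
    hr.continuous_torusIntegrand (m + α) m continuous_const continuous_const continuous_id
  have hper := integral_angleSquare_eq_scaledSquare hc
    (fun θ η => by simp only [torusIntegrand, periodic_circleMap 0 _ η])
    (fun η θ => by simp only [torusIntegrand, periodic_circleMap 0 _ θ]) hN
  rw [torusCoeff, hper]
  simp_rw [← torusIntegrand_bulk hN hs ht]
  rw [integral_const_mul]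
  have : (N : ℂ) ≠ 0 := by exact_mod_cast hN.ne'
  field_simp

end BulkCoordinates

/-! ### A uniform integrable majorant on the growing square -/

section BulkEstimates

lemma bulkPt_sq (N y : ℝ) : bulkPt N y ^ 2 =
    Real.exp (-1 / N) * Complex.exp (((-y / N : ℝ) : ℂ) * Complex.I) := by
  rw [bulkPt, ← Complex.exp_nat_mul, Complex.ofReal_exp, ← Complex.exp_add]
  congr 1
  push_cast
  ring

lemma bulkPt_re (N y : ℝ) :
    (bulkPt N y).re = Real.exp (-1 / (2 * N)) * Real.cos (y / (2 * N)) := by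
  have : bulkPt N y = Complex.exp (((-1 / (2 * N) : ℝ) : ℂ) +
      ((-y / (2 * N) : ℝ) : ℂ) * Complex.I) := by
    rw [bulkPt]; congr 1; push_cast; ring
  rw [this, Complex.exp_re]
  simp only [Complex.add_re, Complex.ofReal_re, Complex.re_ofReal_mul, Complex.I_re, mul_zero,
    add_zero, Complex.add_im, Complex.ofReal_im, Complex.im_ofReal_mul, Complex.I_im, mul_one,
    zero_add]
  rw [neg_div _ y, Real.cos_neg]

lemma normSq_one_sub_bulkPt_sq (N y : ℝ) : ‖1 - bulkPt N y ^ 2‖ ^ 2 =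
    (1 - Real.exp (-1 / N)) ^ 2 + 2 * Real.exp (-1 / N) * (1 - Real.cos (y / N)) := by
  rw [bulkPt_sq, Complex.sq_norm, Complex.normSq_apply]
  simp only [Complex.sub_re, Complex.one_re, Complex.re_ofReal_mul, Complex.exp_ofReal_mul_I_re,
    Complex.sub_im, Complex.one_im, Complex.im_ofReal_mul, Complex.exp_ofReal_mul_I_im]
  rw [neg_div _ y, Real.cos_neg, Real.sin_neg]
  have := Real.sin_sq_add_cos_sq (y / N)
  linear_combination (Real.exp (-1 / N)) ^ 2 * this

lemma one_third_le_exp {N : ℝ} (hN : 1 ≤ N) : 1 / 3 ≤ Real.exp (-1 / N) := by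
  have h1 : -1 ≤ -1 / N := by
    rw [le_div_iff₀ (by linarith)]; linarith
  have h2 : Real.exp 1 < 3 := by linarith [Real.exp_one_lt_d9]
  calc (1 : ℝ) / 3 ≤ 1 / Real.exp 1 := one_div_le_one_div_of_le (Real.exp_pos 1) h2.le
    _ = Real.exp (-1) := by rw [Real.exp_neg, one_div]
    _ ≤ _ := Real.exp_le_exp.2 h1

lemma one_sub_exp_le {N : ℝ} : 1 - Real.exp (-1 / N) ≤ 1 / N := by
  have := Real.add_one_le_exp (-1 / N)
  rw [neg_div] at this ⊢
  linarith

lemma le_one_sub_exp {N : ℝ} (hN : 1 ≤ N) : 1 / (3 * N) ≤ 1 - Real.exp (-1 / N) := by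
  have h1 := Real.add_one_le_exp (1 / N)
  have h2 : Real.exp (1 / N) * Real.exp (-1 / N) = 1 := by
    rw [← Real.exp_add]; simp [neg_div]
  have h3 := one_third_le_exp hN
  have h4 := mul_le_mul_of_nonneg_right h1 (Real.exp_pos (-1 / N)).le
  have hpos : 0 < 1 / N := by positivity
  have h5 : 1 / (3 * N) = 1 / N * (1 / 3) := by field_simp
  rw [h5]
  nlinarith

/-- The squared modulus of 1 - w² splits into (1 - e^{-1/N})², at least (1/(3N))², and 2 e^{-1/N} (1
- cos(y/N)), bounded below by 1 - cos x ≥ 2x²/π² on [-π, π]. -/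
lemma le_norm_one_sub_bulkPt_sq {N y : ℝ} (hN : 1 ≤ N) (hy : |y| ≤ Real.pi * N) :
    √(1 + y ^ 2) / 4 ≤ ‖(N : ℂ) * (1 - bulkPt N y ^ 2)‖ := by
  have hN0 : 0 < N := by linarith
  rw [norm_mul, Complex.norm_real, Real.norm_of_nonneg hN0.le]
  refine (abs_le_of_sq_le_sq' ?_ (by positivity)).2
  rw [mul_pow, normSq_one_sub_bulkPt_sq, div_pow, Real.sq_sqrt (by positivity)]
  have h1 := le_one_sub_exp hN
  have h2 := one_third_le_exp hN
  have h3 := Real.cos_le_one_sub_mul_cos_sq (x := y / N) (by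
    rw [abs_div, abs_of_pos hN0, div_le_iff₀ hN0]; exact hy)
  have h4 : Real.pi ^ 2 < 10 := by nlinarith [Real.pi_lt_d2, Real.pi_pos]
  have h5 : 2 / 10 * (y / N) ^ 2 ≤ 2 / Real.pi ^ 2 * (y / N) ^ 2 := by
    gcongr
  have h6 : (1 / (3 * N)) ^ 2 ≤ (1 - Real.exp (-1 / N)) ^ 2 :=
    pow_le_pow_left₀ (by positivity) h1 2
  have h7 : 2 * (1 / 3) * (2 / 10 * (y / N) ^ 2) ≤
      2 * Real.exp (-1 / N) * (1 - Real.cos (y / N)) := by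
    apply mul_le_mul (by linarith) (by linarith) (by positivity) (by positivity)
  calc (1 + y ^ 2) / 4 ^ 2 ≤ N ^ 2 * ((1 / (3 * N)) ^ 2 + 2 * (1 / 3) * (2 / 10 * (y / N) ^ 2)) := by
        field_simp
        nlinarith [sq_nonneg y]
    _ ≤ _ := by gcongr

lemma norm_one_sub_bulkPt_sq_le {N y : ℝ} (hN : 1 ≤ N) :
    ‖1 - bulkPt N y ^ 2‖ ^ 2 ≤ (1 + y ^ 2) / N ^ 2 := by
  have hN0 : 0 < N := by linarith
  rw [normSq_one_sub_bulkPt_sq]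
  have h0 : 0 ≤ 1 - Real.exp (-1 / N) := le_trans (by positivity) (le_one_sub_exp hN)
  have h1 := one_sub_exp_le (N := N)
  have h2 := Real.one_sub_sq_div_two_le_cos (x := y / N)
  have h3 : (1 - Real.exp (-1 / N)) ^ 2 ≤ (1 / N) ^ 2 := pow_le_pow_left₀ h0 h1 2
  have h4 : 2 * Real.exp (-1 / N) * (1 - Real.cos (y / N)) ≤ 2 * 1 * ((y / N) ^ 2 / 2) :=
    mul_le_mul (by linarith) (by linarith) (by linarith [Real.cos_le_one (y / N)]) (by norm_num)
  calc _ ≤ (1 / N) ^ 2 + 2 * 1 * ((y / N) ^ 2 / 2) := add_le_add h3 h4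
    _ = _ := by field_simp

/-- The Cayley transform maps the unit disc to the right half-plane. -/
lemma re_one_sub_div_one_add_nonneg {w : ℂ} (hw : ‖w‖ < 1) : 0 ≤ ((1 - w) / (1 + w)).re := by
  have h1 : w.re ^ 2 + w.im ^ 2 < 1 := by
    rw [sq, sq, ← Complex.normSq_apply, ← Complex.sq_norm]
    exact pow_lt_one₀ (norm_nonneg _) hw two_ne_zero
  rw [Complex.div_re, ← add_div]
  apply div_nonneg _ (Complex.normSq_nonneg _)
  simp
  nlinarith

lemma re_div_one_sub_sq {w : ℂ} : (2 * w / (1 - w ^ 2)).re =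
    2 * w.re * (1 - ‖w‖ ^ 2) / ‖1 - w ^ 2‖ ^ 2 := by
  rw [Complex.div_re, ← add_div, Complex.sq_norm (1 - w ^ 2), Complex.sq_norm w,
    Complex.normSq_apply w]
  congr 1
  simp [sq]
  ring

lemma norm_bulkPt_sq (N y : ℝ) : ‖bulkPt N y‖ ^ 2 = Real.exp (-1 / N) := by
  rw [norm_bulkPt, ← Real.exp_nat_mul]
  congr 1
  push_cast
  rw [← mul_div_assoc, mul_div_mul_left _ _ (by norm_num)]

lemma bulkPt_re_nonneg {N y : ℝ} (hN : 1 ≤ N) (hy : |y| ≤ Real.pi * N) :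
    0 ≤ (bulkPt N y).re := by
  have hN0 : 0 < N := by linarith
  rw [bulkPt_re]
  refine mul_nonneg (Real.exp_pos _).le (Real.cos_nonneg_of_mem_Icc ?_)
  rw [abs_le] at hy
  constructor
  · rw [le_div_iff₀ (by positivity)]; nlinarith
  · rw [div_le_iff₀ (by positivity)]; nlinarith

lemma re_two_bulkPt_div_nonneg {N y : ℝ} (hN : 1 ≤ N) (hy : |y| ≤ Real.pi * N) :
    0 ≤ (2 * bulkPt N y / (1 - bulkPt N y ^ 2)).re := by
  rw [re_div_one_sub_sq, norm_bulkPt_sq]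
  have h0 : 0 ≤ 1 - Real.exp (-1 / N) := le_trans (by positivity) (le_one_sub_exp hN)
  have := bulkPt_re_nonneg hN hy
  positivity

/-- This coefficient drives the Gaussian decay in τ. The range of y keeps cos(y/(2N)) away from 0,
hence the real part of w bounded below. -/
lemma le_re_two_bulkPt_div {N y : ℝ} (hN : 1 ≤ N) (hy : |y| ≤ Real.pi * N / 2) :
    N / (9 * (1 + y ^ 2)) ≤ (2 * bulkPt N y / (1 - bulkPt N y ^ 2)).re := by
  have hN0 : 0 < N := by linarith
  have hw : ‖1 - bulkPt N y ^ 2‖ ^ 2 > 0 := by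
    have : 1 - bulkPt N y ^ 2 ≠ 0 := one_sub_ne_zero_of_norm_lt (by
      rw [norm_pow]; exact pow_lt_one₀ (norm_nonneg _) (norm_bulkPt_lt_one hN0 y) two_ne_zero)
    positivity
  rw [re_div_one_sub_sq, norm_bulkPt_sq, le_div_iff₀ hw]
  have h1 := norm_one_sub_bulkPt_sq_le (y := y) hN
  have h2 := le_one_sub_exp hN
  have h3 : 1 / 3 * (1 / 2) ≤ (bulkPt N y).re := by
    rw [bulkPt_re]
    refine mul_le_mul (one_third_le_exp (by linarith)) ?_ (by norm_num) (Real.exp_pos _).le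
    have h4 := Real.one_sub_sq_div_two_le_cos (x := y / (2 * N))
    have h5 : (y / (2 * N)) ^ 2 ≤ (Real.pi / 4) ^ 2 := by
      refine sq_le_sq' ?_ ?_ <;> rw [abs_le] at hy
      · rw [le_div_iff₀ (by positivity)]; linarith
      · rw [div_le_iff₀ (by positivity)]; linarith
    have h6 : Real.pi ^ 2 < 10 := by nlinarith [Real.pi_lt_d2, Real.pi_pos]
    nlinarith
  calc N / (9 * (1 + y ^ 2)) * ‖1 - bulkPt N y ^ 2‖ ^ 2
      ≤ N / (9 * (1 + y ^ 2)) * ((1 + y ^ 2) / N ^ 2) := by gcongr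
    _ = 2 * (1 / 3 * (1 / 2)) * (1 / (3 * N)) := by field_simp; norm_num
    _ ≤ 2 * (bulkPt N y).re * (1 - Real.exp (-1 / N)) := by gcongr

/-- The integrable majorant of the rescaled integrands. -/
noncomputable def bulkMajorant (p : ℝ × ℝ) : ℝ :=
  (1 + ‖p.1‖ ^ 2) ^ (-(3 / 2 : ℝ) / 2) * (1 + ‖p.2‖ ^ 2) ^ (-(3 / 2 : ℝ) / 2)

lemma integrable_bulkMajorant : Integrable bulkMajorant := by
  have h : Integrable (fun x : ℝ => (1 + ‖x‖ ^ 2) ^ (-(3 / 2 : ℝ) / 2)) :=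
    integrable_rpow_neg_one_add_norm_sq (by simp; norm_num)
  exact h.mul_prod h

/-- Splitting the sum with weights 1/4 and 3/4 gives both variables the exponent -3/4, that is,
decay of order 3/2, integrable in each. -/
lemma inv_mul_inv_le_bulkMajorant (y τ : ℝ) :
    (√(1 + y ^ 2))⁻¹ * (1 + y ^ 2 + τ ^ 2)⁻¹ ≤ bulkMajorant (y, τ) := by
  have hA : 0 < 1 + y ^ 2 := by positivity
  have hB : 0 < 1 + τ ^ 2 := by positivity
  have hS : (1 + y ^ 2) ^ (1 / 4 : ℝ) * (1 + τ ^ 2) ^ (3 / 4 : ℝ) ≤ 1 + y ^ 2 + τ ^ 2 := by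
    have hS0 : 0 < 1 + y ^ 2 + τ ^ 2 := by positivity
    calc (1 + y ^ 2) ^ (1 / 4 : ℝ) * (1 + τ ^ 2) ^ (3 / 4 : ℝ)
        ≤ (1 + y ^ 2 + τ ^ 2) ^ (1 / 4 : ℝ) * (1 + y ^ 2 + τ ^ 2) ^ (3 / 4 : ℝ) := by
          exact mul_le_mul
            (Real.rpow_le_rpow hA.le (by linarith [sq_nonneg τ]) (by norm_num))
            (Real.rpow_le_rpow hB.le (by linarith [sq_nonneg y]) (by norm_num))
            (by positivity) (by positivity)
      _ = _ := by rw [← Real.rpow_add hS0]; norm_num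
  simp only [bulkMajorant, Real.norm_eq_abs, sq_abs]
  have e1 : (1 + y ^ 2) ^ (-(3 / 2 : ℝ) / 2) =
      (√(1 + y ^ 2))⁻¹ * ((1 + y ^ 2) ^ (1 / 4 : ℝ))⁻¹ := by
    rw [Real.sqrt_eq_rpow, ← Real.rpow_neg hA.le, ← Real.rpow_neg hA.le, ← Real.rpow_add hA]
    norm_num
  have e2 : (1 + τ ^ 2) ^ (-(3 / 2 : ℝ) / 2) = ((1 + τ ^ 2) ^ (3 / 4 : ℝ))⁻¹ := by
    rw [← Real.rpow_neg hB.le]; norm_num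
  rw [e1, e2, mul_assoc, ← mul_inv ((1 + y ^ 2) ^ (1 / 4 : ℝ))]
  exact mul_le_mul_of_nonneg_left (inv_anti₀ (by positivity) hS) (by positivity)

/-- The cubic pole gives (1 + y²)^{-3/2}. The Gaussian in τ is weakened to a multiple of (1 + y²)/(1
+ y² + τ²), which is enough for `bulkMajorant`. The power of w stays below e because 2m + α ≤ 2N. -/
lemma norm_bulkIntegrand_le {c κ N s t : ℝ} {α m : ℕ} (hκ : 0 < κ) (hN : 1 ≤ N) (hs : 0 < s)
    (ht : 0 < t) (hq : κ * N ≤ √(s * t)) (hm : (2 * m + α : ℝ) ≤ 2 * N) {p : ℝ × ℝ}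
    (hp : p ∈ scaledSquare N) :
    ‖bulkIntegrand c α m N s t p‖ ≤
      64 * Real.exp 1 * (Real.exp |c| * (5 + 45 / κ)) * bulkMajorant p := by
  obtain ⟨y, τ⟩ := p
  have hN0 : 0 < N := by linarith
  obtain ⟨hy, hτ⟩ := hp
  have hy : |y| ≤ Real.pi * N := abs_le.2 hy
  have hτ : |τ| ≤ Real.pi * N := abs_le.2 hτ
  have hA : 0 < 1 + y ^ 2 := by positivity
  have hq0 : 0 ≤ √(s * t) := Real.sqrt_nonneg _
  have hamgm : √(s * t) ≤ (s + t) / 2 := by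
    rw [Real.sqrt_le_left (by positivity)]
    nlinarith [sq_nonneg (s - t)]
  have hb1 : ‖((N * (1 - bulkPt N y ^ 2)) ^ 3 : ℂ)⁻¹‖ ≤ 64 * (√(1 + y ^ 2))⁻¹ * (1 + y ^ 2)⁻¹ := by
    have h1 := le_norm_one_sub_bulkPt_sq hN hy
    have h2 : 0 < √(1 + y ^ 2) := Real.sqrt_pos.2 hA
    rw [norm_inv, norm_pow]
    calc (‖(N : ℂ) * (1 - bulkPt N y ^ 2)‖ ^ 3)⁻¹ ≤ ((√(1 + y ^ 2) / 4) ^ 3)⁻¹ := by gcongr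
      _ = 64 * (√(1 + y ^ 2))⁻¹ * (√(1 + y ^ 2) ^ 2)⁻¹ := by field_simp; norm_num
      _ = _ := by rw [Real.sq_sqrt hA.le]
  have hb2 : ‖(bulkPt N y ^ (2 * m + α))⁻¹‖ ≤ Real.exp 1 := by
    rw [norm_inv, norm_pow, norm_bulkPt, ← Real.exp_nat_mul, ← Real.exp_neg, Real.exp_le_exp]
    push_cast
    rw [mul_div_assoc', ← neg_div, div_le_one (by positivity)]
    linarith
  have hb3 : ‖Complex.exp (-(α * (τ / N) * Complex.I))‖ = 1 := by
    have : (-(α * (τ / N) * Complex.I) : ℂ) = ((-(α * (τ / N)) : ℝ) : ℂ) * Complex.I := by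
      push_cast; ring
    rw [this, Complex.norm_exp_ofReal_mul_I]
  have hb4 : ‖Complex.exp (c * bulkPt N y ^ 2
      - (s + t) / 2 * ((1 - bulkPt N y) / (1 + bulkPt N y))
      - ((s + t) / 2 - √(s * t) * Real.cos (τ / N) : ℝ) *
        (2 * bulkPt N y / (1 - bulkPt N y ^ 2)))‖ ≤
      Real.exp |c| * (5 + 45 / κ) * ((1 + y ^ 2) * (1 + y ^ 2 + τ ^ 2)⁻¹) := by
    have hre1 := re_one_sub_div_one_add_nonneg (norm_bulkPt_lt_one hN0 y)
    have hre2 := re_two_bulkPt_div_nonneg hN hy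
    have hcre : (c * bulkPt N y ^ 2 : ℂ).re ≤ |c| := by
      refine (Complex.re_le_norm _).trans ?_
      rw [norm_mul, norm_pow, Complex.norm_real, Real.norm_eq_abs]
      exact mul_le_of_le_one_right (abs_nonneg _)
        (pow_le_one₀ (norm_nonneg _) (norm_bulkPt_lt_one hN0 y).le)
    have hcos := Real.cos_le_one_sub_mul_cos_sq (x := τ / N) (by
      rw [abs_div, abs_of_pos hN0, div_le_iff₀ hN0]; exact hτ)
    have hpi : Real.pi ^ 2 < 10 := by nlinarith [Real.pi_lt_d2, Real.pi_pos]
    have hcos2 : 2 / 10 * (τ / N) ^ 2 ≤ 1 - Real.cos (τ / N) := by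
      have : 2 / 10 * (τ / N) ^ 2 ≤ 2 / Real.pi ^ 2 * (τ / N) ^ 2 := by gcongr
      linarith
    have hst2 : (((s : ℂ) + t) / 2) = (((s + t) / 2 : ℝ) : ℂ) := by push_cast; ring
    rw [Complex.norm_exp, hst2, Complex.sub_re, Complex.sub_re,
      Complex.re_ofReal_mul ((s + t) / 2),
      Complex.re_ofReal_mul ((s + t) / 2 - √(s * t) * Real.cos (τ / N))]
    set R₁ := ((1 - bulkPt N y) / (1 + bulkPt N y)).re
    set R₂ := (2 * bulkPt N y / (1 - bulkPt N y ^ 2)).re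
    -- By AM-GM the left-over mean dominates √(st) (1 - cos(τ/N)).
    have hquad : 2 / 10 * (τ / N) ^ 2 * (κ * N) ≤ (s + t) / 2 - √(s * t) * Real.cos (τ / N) := by
      have h1 : 2 / 10 * (τ / N) ^ 2 * (κ * N) ≤ (1 - Real.cos (τ / N)) * √(s * t) :=
        mul_le_mul hcos2 hq (by positivity) (le_trans (by positivity) hcos2)
      nlinarith
    have hexp1 : Real.exp ((c * bulkPt N y ^ 2 : ℂ).re - (s + t) / 2 * R₁ -
        ((s + t) / 2 - √(s * t) * Real.cos (τ / N)) * R₂) ≤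
        Real.exp |c| * Real.exp (-(2 / 10 * (τ / N) ^ 2 * (κ * N) * R₂)) := by
      rw [← Real.exp_add, Real.exp_le_exp]
      have h1 : 0 ≤ (s + t) / 2 * R₁ := by positivity
      have h2 := mul_le_mul_of_nonneg_right hquad hre2
      linarith
    refine hexp1.trans ?_
    rw [mul_assoc (Real.exp |c|)]
    refine mul_le_mul_of_nonneg_left ?_ (Real.exp_pos _).le
    rcases le_or_gt |y| (Real.pi * N / 2) with hy2 | hy2
    · have h1 := le_re_two_bulkPt_div hN hy2
      have h2 : κ / 45 * (τ ^ 2 / (1 + y ^ 2)) ≤ 2 / 10 * (τ / N) ^ 2 * (κ * N) * R₂ := by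
        calc κ / 45 * (τ ^ 2 / (1 + y ^ 2)) =
            2 / 10 * (τ / N) ^ 2 * (κ * N) * (N / (9 * (1 + y ^ 2))) := by field_simp; ring
          _ ≤ _ := by gcongr
      set T := τ ^ 2 / (1 + y ^ 2) with hT
      have hT0 : 0 ≤ T := by positivity
      have h3 : (1 + y ^ 2) * (1 + y ^ 2 + τ ^ 2)⁻¹ = (1 + T)⁻¹ := by
        rw [hT]; field_simp
      rw [h3, ← div_eq_mul_inv, Real.exp_neg, inv_eq_one_div, div_le_div_iff₀ (Real.exp_pos _)
        (by positivity)]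
      have h4 := Real.add_one_le_exp (2 / 10 * (τ / N) ^ 2 * (κ * N) * R₂)
      have h5 : 1 + κ / 45 * T ≤ Real.exp (2 / 10 * (τ / N) ^ 2 * (κ * N) * R₂) := by linarith
      calc 1 * (1 + T) ≤ (5 + 45 / κ) * (1 + κ / 45 * T) := by
            have : (5 + 45 / κ) * (1 + κ / 45 * T) = 5 + 45 / κ + κ / 9 * T + T := by
              field_simp; ring
            rw [this]
            have : 0 ≤ 45 / κ := by positivity
            have : 0 ≤ κ / 9 * T := by positivity
            linarith
        _ ≤ _ := by gcongr
    -- For |y| > πN/2 no decay is needed: |τ| ≤ πN < 2|y| keeps the rational factor above 1/5, which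
    -- the summand 5 absorbs.
    · have h1 : Real.exp (-(2 / 10 * (τ / N) ^ 2 * (κ * N) * R₂)) ≤ 1 := by
        rw [Real.exp_le_one_iff, neg_nonpos]; positivity
      have h2 : τ ^ 2 ≤ 4 * y ^ 2 := by
        rw [← sq_abs τ, ← sq_abs y]
        nlinarith [abs_nonneg τ, abs_nonneg y]
      have h3 : 1 / 5 ≤ (1 + y ^ 2) * (1 + y ^ 2 + τ ^ 2)⁻¹ := by
        rw [← div_eq_mul_inv, div_le_div_iff₀ (by norm_num) (by positivity)]
        nlinarith
      have h4 : 0 ≤ 45 / κ := by positivity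
      nlinarith
  rw [bulkIntegrand]
  dsimp only
  rw [norm_mul, norm_mul, norm_mul, hb3, mul_one]
  have hmaj := inv_mul_inv_le_bulkMajorant y τ
  calc _ ≤ (64 * (√(1 + y ^ 2))⁻¹ * (1 + y ^ 2)⁻¹) *
        (Real.exp |c| * (5 + 45 / κ) * ((1 + y ^ 2) * (1 + y ^ 2 + τ ^ 2)⁻¹)) * Real.exp 1 := by
        gcongr
    _ = 64 * Real.exp 1 * (Real.exp |c| * (5 + 45 / κ)) *
        ((√(1 + y ^ 2))⁻¹ * (1 + y ^ 2 + τ ^ 2)⁻¹) := by field_simp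
    _ ≤ _ := by gcongr

end BulkEstimates

/-! ### Pointwise limit and dominated convergence -/

section BulkLimit

lemma tendsto_natCast_mul_sub_of_hasDerivAt {E : Type*} [NormedAddCommGroup E] [NormedSpace ℝ E]
    {f : ℝ → E} {f' : E} (hf : HasDerivAt f f' 0) :
    Tendsto (fun N : ℕ => (N : ℝ) • (f (N : ℝ)⁻¹ - f 0)) atTop (𝓝 f') := by
  have h := hf.tendsto_slope_zero_right.comp
    ((tendsto_inv_atTop_nhdsGT_zero (𝕜 := ℝ)).comp tendsto_natCast_atTop_atTop)
  refine h.congr fun N => ?_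
  simp

lemma tendsto_natCast_mul_one_sub_cexp (z : ℂ) :
    Tendsto (fun N : ℕ => (N : ℂ) * (1 - Complex.exp (-z / N))) atTop (𝓝 z) := by
  have h : HasDerivAt (fun h : ℝ => Complex.exp (-z * h)) (-z) 0 := by
    have h1 : HasDerivAt (fun h : ℝ => -z * (h : ℂ)) (-z) 0 := by
      simpa using (Complex.ofRealCLM.hasDerivAt (x := (0 : ℝ))).const_mul (-z)
    simpa using h1.cexp
  have h2 := (tendsto_natCast_mul_sub_of_hasDerivAt h).neg
  rw [neg_neg] at h2
  refine h2.congr fun N => ?_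
  simp only [Complex.ofReal_inv, Complex.ofReal_natCast, Complex.ofReal_zero, mul_zero,
    Complex.exp_zero, Complex.real_smul, div_eq_mul_inv]
  ring

lemma tendsto_natCast_sq_mul_one_sub_cos (τ : ℝ) :
    Tendsto (fun N : ℕ => (N : ℝ) ^ 2 * (1 - Real.cos (τ / N))) atTop (𝓝 (τ ^ 2 / 2)) := by
  have h : HasDerivAt (fun h : ℝ => Real.sin (τ / 2 * h)) (τ / 2) 0 := by
    simpa using ((hasDerivAt_id (0 : ℝ)).const_mul (τ / 2)).sin
  have h2 := ((tendsto_natCast_mul_sub_of_hasDerivAt h).pow 2).const_mul 2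
  have e : 2 * (τ / 2) ^ 2 = τ ^ 2 / 2 := by ring
  rw [e] at h2
  refine h2.congr fun N => ?_
  have h3 := Real.cos_sq (τ / 2 * (N : ℝ)⁻¹)
  have h4 := Real.sin_sq_add_cos_sq (τ / 2 * (N : ℝ)⁻¹)
  have h5 : 2 * (τ / 2 * (N : ℝ)⁻¹) = τ / N := by ring
  rw [h5] at h3
  simp only [mul_zero, Real.sin_zero, sub_zero, smul_eq_mul]
  linear_combination 2 * (N : ℝ) ^ 2 * h4 - 2 * (N : ℝ) ^ 2 * h3

lemma tendsto_affine_div (ξ μ : ℝ) :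
    Tendsto (fun N : ℕ => (N * ξ + μ) / (N : ℝ)) atTop (𝓝 ξ) := by
  have h : Tendsto (fun N : ℕ => ξ + μ * (N : ℝ)⁻¹) atTop (𝓝 (ξ + μ * 0)) :=
    ((tendsto_inv_atTop_nhds_zero_nat (𝕜 := ℝ)).const_mul μ).const_add ξ
  rw [mul_zero, add_zero] at h
  refine h.congr' ?_
  filter_upwards [eventually_gt_atTop 0] with N hN
  have : (N : ℝ) ≠ 0 := by exact_mod_cast hN.ne'
  field_simp

lemma tendsto_sqrt_affine_div {ξ : ℝ} (hξ : 0 < ξ) (μ ν : ℝ) :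
    Tendsto (fun N : ℕ => √((N * ξ + μ) * (N * ξ + ν)) / (N : ℝ)) atTop (𝓝 ξ) := by
  have h := ((tendsto_affine_div ξ μ).mul (tendsto_affine_div ξ ν)).sqrt
  rw [Real.sqrt_mul_self hξ.le] at h
  refine h.congr fun N => ?_
  rw [div_mul_div_comm, Real.sqrt_div' _ (by positivity), Real.sqrt_mul_self (by positivity)]

lemma eventually_affine_pos {ξ : ℝ} (hξ : 0 < ξ) (μ : ℝ) :
    ∀ᶠ N : ℕ in atTop, 0 < N * ξ + μ := by
  have h : Tendsto (fun N : ℕ => (N : ℝ) * ξ + μ) atTop atTop :=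
    tendsto_atTop_add_const_right _ _ (tendsto_natCast_atTop_atTop.atTop_mul_const hξ)
  exact h.eventually_gt_atTop 0

/-- The gap between arithmetic and geometric mean, rationalised, is (μ - ν)²/4 over the sum of the
two means and gives the first term; √(st) (1 - cos(τ/N)) gives the second. -/
lemma tendsto_mul_mean_sub_cos {ξ : ℝ} (hξ : 0 < ξ) (μ ν τ : ℝ) :
    Tendsto (fun N : ℕ => (N : ℝ) * (((N * ξ + μ) + (N * ξ + ν)) / 2 -
      √((N * ξ + μ) * (N * ξ + ν)) * Real.cos (τ / N))) atTop
      (𝓝 ((μ - ν) ^ 2 / (8 * ξ) + ξ * τ ^ 2 / 2)) := by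
  have hsum : Tendsto (fun N : ℕ => ((μ - ν) ^ 2 / 4) /
      (((N * ξ + μ) / (N : ℝ) + (N * ξ + ν) / N) / 2 + √((N * ξ + μ) * (N * ξ + ν)) / (N : ℝ)))
      atTop (𝓝 (((μ - ν) ^ 2 / 4) / ((ξ + ξ) / 2 + ξ))) :=
    tendsto_const_nhds.div ((((tendsto_affine_div ξ μ).add (tendsto_affine_div ξ ν)).div_const 2).add
      (tendsto_sqrt_affine_div hξ μ ν)) (by positivity)
  have h := hsum.add ((tendsto_sqrt_affine_div hξ μ ν).mul (tendsto_natCast_sq_mul_one_sub_cos τ))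
  have e : (μ - ν) ^ 2 / 4 / ((ξ + ξ) / 2 + ξ) + ξ * (τ ^ 2 / 2) =
      (μ - ν) ^ 2 / (8 * ξ) + ξ * τ ^ 2 / 2 := by field_simp; ring
  rw [e] at h
  refine h.congr' ?_
  filter_upwards [eventually_gt_atTop 0, eventually_affine_pos hξ μ, eventually_affine_pos hξ ν]
    with N hN hs ht
  have hN0 : (0 : ℝ) < N := by exact_mod_cast hN
  set q := √((N * ξ + μ) * (N * ξ + ν))
  have hq : 0 < q := Real.sqrt_pos.2 (mul_pos hs ht)
  have hqq : q ^ 2 = (N * ξ + μ) * (N * ξ + ν) := Real.sq_sqrt (mul_pos hs ht).le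
  have hne : (N * ξ + μ) + (N * ξ + ν) + 2 * q ≠ 0 := by positivity
  have h1 : (μ - ν) ^ 2 / 4 / (((N * ξ + μ) / (N : ℝ) + (N * ξ + ν) / N) / 2 + q / N) =
      N * (((N * ξ + μ) + (N * ξ + ν)) / 2 - q) := by
    have : (((N * ξ + μ) / (N : ℝ) + (N * ξ + ν) / N) / 2 + q / N) =
      ((N * ξ + μ) + (N * ξ + ν) + 2 * q) / (2 * N) := by field_simp
    rw [this, div_div_eq_mul_div, div_eq_iff hne]
    linear_combination 2 * (N : ℝ) * hqq
  rw [h1]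
  field_simp
  ring

/-- The pointwise limit of the rescaled integrands. -/
noncomputable def bulkLimit (c ξ d : ℝ) (p : ℝ × ℝ) : ℂ :=
  ((1 + p.1 * Complex.I) ^ 3)⁻¹ * Complex.exp (c + (1 - ξ / 4) * (1 + p.1 * Complex.I)
    - d ^ 2 / (4 * ξ) / (1 + p.1 * Complex.I) - ξ * p.2 ^ 2 / (1 + p.1 * Complex.I))

lemma one_add_mul_I_ne_zero (y : ℝ) : (1 + y * Complex.I : ℂ) ≠ 0 := by
  intro h
  simpa using congrArg Complex.re h

/-- With ζ = 1 + iy, the limits are N(1 - w) → ζ/2, N(1 - w²) → ζ and w^{-(2N-α)} → e^ζ. The shift α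
is negligible against N and disappears. -/
lemma tendsto_bulkIntegrand {ξ : ℝ} (hξ : 0 < ξ) (c μ ν : ℝ) (α : ℕ) (p : ℝ × ℝ) :
    Tendsto (fun N : ℕ => bulkIntegrand c α (N - α) N (N * ξ + μ) (N * ξ + ν) p) atTop
      (𝓝 (bulkLimit c ξ (μ - ν) p)) := by
  obtain ⟨y, τ⟩ := p
  set ζ : ℂ := 1 + y * Complex.I with hζ
  have hζ0 : ζ ≠ 0 := one_add_mul_I_ne_zero y
  have hN0 : ∀ᶠ N : ℕ in atTop, (N : ℂ) ≠ 0 := by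
    filter_upwards [eventually_gt_atTop 0] with N hN
    exact_mod_cast hN.ne'
  have hinv : Tendsto (fun N : ℕ => (N : ℂ)⁻¹) atTop (𝓝 0) := tendsto_inv_atTop_nhds_zero_nat
  have hA : Tendsto (fun N : ℕ => (N : ℂ) * (1 - bulkPt N y)) atTop (𝓝 (ζ / 2)) := by
    refine (tendsto_natCast_mul_one_sub_cexp (ζ / 2)).congr fun N => ?_
    rw [bulkPt, hζ]
    congr 3
    push_cast
    rw [← neg_div, div_div]
  have hB : Tendsto (fun N : ℕ => (N : ℂ) * (1 - bulkPt N y ^ 2)) atTop (𝓝 ζ) := by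
    refine (tendsto_natCast_mul_one_sub_cexp ζ).congr fun N => ?_
    rw [bulkPt, ← Complex.exp_nat_mul]
    congr 3
    push_cast
    rw [mul_div_assoc', mul_div_mul_left _ _ two_ne_zero]
  have hw : Tendsto (fun N : ℕ => bulkPt N y) atTop (𝓝 1) := by
    have h := (hinv.const_mul (-ζ / 2)).cexp
    rw [mul_zero, Complex.exp_zero] at h
    refine h.congr fun N => ?_
    rw [bulkPt]
    congr 1
    push_cast
    rw [div_mul_eq_mul_div, ← div_eq_mul_inv, div_div, mul_comm 2 (N : ℂ)]
  have hmean : Tendsto (fun N : ℕ => ((((N * ξ + μ) / N + (N * ξ + ν) / N) / 2 : ℝ) : ℂ)) atTop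
      (𝓝 ((((ξ + ξ) / 2 : ℝ)) : ℂ)) :=
    (((tendsto_affine_div ξ μ).add (tendsto_affine_div ξ ν)).div_const 2).ofReal
  have hE := ((((hw.pow 2).const_mul (c : ℂ)).sub (hmean.mul (hA.div (hw.const_add 1)
    (by norm_num)))).sub ((tendsto_mul_mean_sub_cos hξ μ ν τ).ofReal.mul
      ((hw.const_mul 2).div hB hζ0))).cexp
  have hpow : Tendsto (fun N : ℕ => (bulkPt N y ^ (2 * (N - α) + α))⁻¹) atTop
      (𝓝 (Complex.exp ζ)) := by
    have h := ((hinv.const_mul (α * ζ / 2)).const_sub ζ).cexp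
    rw [mul_zero, sub_zero] at h
    refine h.congr' ?_
    filter_upwards [hN0, eventually_ge_atTop α] with N hN hα
    rw [bulkPt, ← Complex.exp_nat_mul, ← Complex.exp_neg]
    congr 1
    push_cast [Nat.cast_sub hα]
    field_simp
    ring
  have hlast : Tendsto (fun N : ℕ => Complex.exp (-(α * (τ / (N : ℝ)) * Complex.I))) atTop
      (𝓝 1) := by
    have h := (hinv.const_mul (-(α * τ * Complex.I))).cexp
    rw [mul_zero, Complex.exp_zero] at h
    refine h.congr fun N => ?_
    congr 1
    push_cast
    ring
  have hall := ((((hB.pow 3).inv₀ (pow_ne_zero 3 hζ0)).mul hE).mul hpow).mul hlast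
  have e : (ζ ^ 3)⁻¹ * Complex.exp (c * 1 ^ 2 - (((ξ + ξ) / 2 : ℝ) : ℂ) * (ζ / 2 / (1 + 1)) -
      (((μ - ν) ^ 2 / (8 * ξ) + ξ * τ ^ 2 / 2 : ℝ) : ℂ) * (2 * 1 / ζ)) * Complex.exp ζ * 1 =
      bulkLimit c ξ (μ - ν) (y, τ) := by
    have hξ0 : (ξ : ℂ) ≠ 0 := by exact_mod_cast hξ.ne'
    rw [bulkLimit, mul_one, mul_assoc, ← Complex.exp_add]
    congr 2
    dsimp only
    rw [← hζ]
    push_cast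
    field_simp
    ring
  rw [e] at hall
  refine hall.congr' ?_
  filter_upwards [hN0] with N hN
  have hN' : (N : ℝ) ≠ 0 := by exact_mod_cast hN
  rw [bulkIntegrand]
  dsimp only
  congr 3
  simp only [Pi.div_apply]
  push_cast
  congr 2
  · field_simp
  · field_simp

lemma continuous_bulkPt (N : ℝ) : Continuous (bulkPt N) := by
  unfold bulkPt; fun_prop

lemma continuous_bulkIntegrand (c : ℝ) (α m : ℕ) {N : ℝ} (hN : 0 < N) (s t : ℝ) :
    Continuous (bulkIntegrand c α m N s t) := by
  have hb := continuous_bulkPt N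
  have h1 : ∀ p : ℝ × ℝ, 1 + bulkPt N p.1 ≠ 0 := fun p =>
    one_add_ne_zero_of_norm_lt (norm_bulkPt_lt_one hN _)
  have h2 : ∀ p : ℝ × ℝ, 1 - bulkPt N p.1 ^ 2 ≠ 0 := fun p =>
    one_sub_ne_zero_of_norm_lt (by
      rw [norm_pow]; exact pow_lt_one₀ (norm_nonneg _) (norm_bulkPt_lt_one hN _) two_ne_zero)
  have h3 : ∀ p : ℝ × ℝ, bulkPt N p.1 ^ (2 * m + α) ≠ 0 := fun p =>
    pow_ne_zero _ (Complex.exp_ne_zero _)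
  have h4 : ∀ p : ℝ × ℝ, ((N : ℂ) * (1 - bulkPt N p.1 ^ 2)) ^ 3 ≠ 0 := fun p =>
    pow_ne_zero _ (mul_ne_zero (by exact_mod_cast hN.ne') (h2 p))
  unfold bulkIntegrand
  fun_prop (disch := assumption)

lemma continuous_bulkLimit (c ξ d : ℝ) : Continuous (bulkLimit c ξ d) := by
  have h : ∀ p : ℝ × ℝ, (1 + p.1 * Complex.I : ℂ) ≠ 0 := fun p => one_add_mul_I_ne_zero p.1
  have h' : ∀ p : ℝ × ℝ, (1 + p.1 * Complex.I : ℂ) ^ 3 ≠ 0 := fun p => pow_ne_zero _ (h p)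
  unfold bulkLimit
  fun_prop (disch := assumption)

lemma measurableSet_scaledSquare (N : ℝ) : MeasurableSet (scaledSquare N) :=
  measurableSet_Icc.prod measurableSet_Icc

lemma eventually_mem_scaledSquare (p : ℝ × ℝ) :
    ∀ᶠ N : ℕ in atTop, p ∈ scaledSquare N := by
  have h : Tendsto (fun N : ℕ => Real.pi * (N : ℝ)) atTop atTop :=
    tendsto_natCast_atTop_atTop.const_mul_atTop Real.pi_pos
  filter_upwards [h.eventually_ge_atTop |p.1|, h.eventually_ge_atTop |p.2|] with N h1 h2
  exact ⟨abs_le.1 h1, abs_le.1 h2⟩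

lemma eventually_norm_bulkIntegrand_le {ξ : ℝ} (hξ : 0 < ξ) (c μ ν : ℝ) (α : ℕ) :
    ∀ᶠ N : ℕ in atTop, ∀ p ∈ scaledSquare N,
      ‖bulkIntegrand c α (N - α) N (N * ξ + μ) (N * ξ + ν) p‖ ≤
        64 * Real.exp 1 * (Real.exp |c| * (5 + 45 / (ξ / 2))) * bulkMajorant p := by
  filter_upwards [eventually_affine_pos hξ μ, eventually_affine_pos hξ ν, eventually_ge_atTop 1,
    eventually_ge_atTop α, (tendsto_sqrt_affine_div hξ μ ν).eventually_const_le (half_lt_self hξ)]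
    with N hs ht hN hα hq p hp
  have hN1 : (1 : ℝ) ≤ N := by exact_mod_cast hN
  refine norm_bulkIntegrand_le (by positivity) hN1 hs ht ?_ ?_ hp
  · rwa [le_div_iff₀ (by linarith)] at hq
  · have : 2 * (N - α) + α ≤ 2 * N := by omega
    exact_mod_cast this

lemma tendsto_integral_bulkIntegrand {ξ : ℝ} (hξ : 0 < ξ) (c μ ν : ℝ) (α : ℕ) :
    Tendsto (fun N : ℕ => ∫ p in scaledSquare N,
      bulkIntegrand c α (N - α) N (N * ξ + μ) (N * ξ + ν) p) atTop
      (𝓝 (∫ p, bulkLimit c ξ (μ - ν) p)) := by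
  simp_rw [← integral_indicator (measurableSet_scaledSquare _)]
  refine tendsto_integral_filter_of_dominated_convergence
    (fun p => 64 * Real.exp 1 * (Real.exp |c| * (5 + 45 / (ξ / 2))) * bulkMajorant p) ?_ ?_
    (integrable_bulkMajorant.const_mul _) ?_
  · filter_upwards [eventually_gt_atTop 0] with N hN
    exact (continuous_bulkIntegrand c α (N - α) (by exact_mod_cast hN)
      _ _).aestronglyMeasurable.indicator (measurableSet_scaledSquare _)
  · filter_upwards [eventually_norm_bulkIntegrand_le hξ c μ ν α] with N hN
    refine Eventually.of_forall fun p => ?_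
    by_cases hp : p ∈ scaledSquare N
    · rw [Set.indicator_of_mem hp]
      exact hN p hp
    · rw [Set.indicator_of_notMem hp, norm_zero]
      have : 0 ≤ bulkMajorant p := by unfold bulkMajorant; positivity
      positivity
  · refine Eventually.of_forall fun p => ?_
    refine (tendsto_bulkIntegrand hξ c μ ν α p).congr' ?_
    filter_upwards [eventually_mem_scaledSquare p] with N hp
    rw [Set.indicator_of_mem hp]

/-- The limit inherits the uniform majorant; any μ, ν with difference d and any α would serve. -/
lemma integrable_bulkLimit {ξ : ℝ} (hξ : 0 < ξ) (c d : ℝ) : Integrable (bulkLimit c ξ d) := by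
  refine (integrable_bulkMajorant.const_mul
    (64 * Real.exp 1 * (Real.exp |c| * (5 + 45 / (ξ / 2))))).mono'
    (continuous_bulkLimit c ξ d).aestronglyMeasurable (Eventually.of_forall fun p => ?_)
  have h := (tendsto_bulkIntegrand hξ c d 0 0 p).norm
  rw [sub_zero] at h
  refine le_of_tendsto h ?_
  filter_upwards [eventually_norm_bulkIntegrand_le hξ c d 0 0, eventually_mem_scaledSquare p]
    with N h1 h2
  exact h1 p h2

end BulkLimit

/-! ### Evaluation of the limiting integral -/

section BulkIntegral

lemma norm_one_add_mul_I_sq (y : ℝ) : ‖(1 + y * Complex.I : ℂ)‖ ^ 2 = 1 + y ^ 2 := by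
  rw [Complex.sq_norm, Complex.normSq_apply]
  simp [sq]

lemma integrable_inv_one_add_mul_I_sq :
    Integrable (fun y : ℝ => ((1 + y * Complex.I : ℂ) ^ 2)⁻¹) := by
  have h : ∀ y : ℝ, (1 + y * Complex.I : ℂ) ^ 2 ≠ 0 := fun y =>
    pow_ne_zero _ (one_add_mul_I_ne_zero y)
  refine integrable_inv_one_add_sq.mono' (by fun_prop (disch := assumption) :
    Continuous _).aestronglyMeasurable (Eventually.of_forall fun y => ?_)
  rw [norm_inv, norm_pow, norm_one_add_mul_I_sq]

lemma integrable_rampExp : Integrable (fun v : ℝ => ((max v 0 * Real.exp (-v) : ℝ) : ℂ)) := by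
  have h0 := Real.GammaIntegral_convergent (s := 2) (by norm_num)
  have h1 : IntegrableOn (fun v : ℝ => max v 0 * Real.exp (-v)) (Set.Ioi 0) := by
    refine h0.congr_fun (fun v hv => ?_) measurableSet_Ioi
    have hv' : 0 < v := hv
    simp only
    rw [max_eq_left hv'.le, mul_comm]
    norm_num
  refine Integrable.ofReal ((integrableOn_iff_integrable_of_support_subset
    (f := fun v : ℝ => max v 0 * Real.exp (-v)) fun v hv => ?_).1 h1)
  by_contra h0
  rw [Set.mem_Ioi, not_lt] at h0
  exact hv (by simp only [max_eq_right h0, zero_mul])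

lemma integral_mul_cexp_neg_mul_Ioi {z : ℂ} (hz : 0 < z.re) :
    ∫ v in Set.Ioi (0 : ℝ), (v : ℂ) * Complex.exp (-z * v) = (z ^ 2)⁻¹ := by
  have hz0 : z ≠ 0 := by rintro rfl; simp at hz
  have hd : ∀ v : ℝ, HasDerivAt (fun v : ℝ => -((v : ℂ) / z + 1 / z ^ 2) * Complex.exp (-z * v))
      ((v : ℂ) * Complex.exp (-z * v)) v := by
    intro v
    have h1 : HasDerivAt (fun v : ℝ => (v : ℂ)) 1 v := Complex.ofRealCLM.hasDerivAt
    refine (((h1.div_const z).add_const (1 / z ^ 2)).neg.mul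
      ((h1.const_mul (-z)).cexp)).congr_deriv ?_
    simp only [Pi.neg_apply]
    field_simp
    ring
  have hnorm : ∀ v : ℝ, ‖Complex.exp (-z * v)‖ = Real.exp (-(z.re * v)) := by
    intro v
    rw [Complex.norm_exp]
    congr 1
    simp
  have hlim : ∀ n : ℕ, Tendsto (fun v : ℝ => v ^ n * Real.exp (-(z.re * v))) atTop (𝓝 0) := by
    intro n
    have h := ((Real.tendsto_pow_mul_exp_neg_atTop_nhds_zero n).comp
      (tendsto_id.const_mul_atTop hz)).const_mul ((z.re ^ n)⁻¹)
    rw [mul_zero] at h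
    refine h.congr fun v => ?_
    simp only [Function.comp_apply, id]
    rw [mul_pow]
    field_simp
  have htend : Tendsto (fun v : ℝ => -((v : ℂ) / z + 1 / z ^ 2) * Complex.exp (-z * v)) atTop
      (𝓝 0) := by
    rw [tendsto_zero_iff_norm_tendsto_zero]
    have h := ((hlim 1).mul_const ‖z‖⁻¹).add ((hlim 0).mul_const (‖z‖ ^ 2)⁻¹)
    rw [zero_mul, zero_mul, add_zero] at h
    refine squeeze_zero' (Eventually.of_forall fun v => norm_nonneg _) ?_ h
    filter_upwards [eventually_ge_atTop 0] with v hv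
    rw [norm_mul, norm_neg, hnorm, pow_one, pow_zero]
    calc _ ≤ (‖(v : ℂ) / z‖ + ‖1 / z ^ 2‖) * Real.exp (-(z.re * v)) := by
          gcongr; exact norm_add_le _ _
      _ = _ := by
          rw [norm_div, norm_div, norm_one, norm_pow, Complex.norm_real, Real.norm_of_nonneg hv]
          ring
  have hint : IntegrableOn (fun v : ℝ => (v : ℂ) * Complex.exp (-z * v)) (Set.Ioi 0) := by
    have h0 := integrableOn_rpow_mul_exp_neg_mul_rpow (p := 1) (s := 1) (by norm_num) one_pos hz
    refine Integrable.mono' h0 (by fun_prop : Continuous _).aestronglyMeasurable ?_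
    filter_upwards [ae_restrict_mem measurableSet_Ioi] with v hv
    rw [norm_mul, hnorm, Complex.norm_real, Real.norm_of_nonneg (le_of_lt hv), Real.rpow_one,
      neg_mul]
  rw [integral_Ioi_of_hasDerivAt_of_tendsto' (fun v _ => hd v) hint htend]
  simp

lemma fourier_rampExp (w : ℝ) :
    FourierTransform.fourier (fun v : ℝ => ((max v 0 * Real.exp (-v) : ℝ) : ℂ)) w =
      ((1 + (2 * Real.pi * w : ℝ) * Complex.I) ^ 2)⁻¹ := by
  rw [Real.fourier_real_eq_integral_exp_smul, ← integral_mul_cexp_neg_mul_Ioi (by simp),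
    ← setIntegral_eq_integral_of_forall_compl_eq_zero (s := Set.Ioi 0)]
  · refine setIntegral_congr_fun measurableSet_Ioi fun v hv => ?_
    have hv' : 0 < v := hv
    rw [max_eq_left hv'.le, smul_eq_mul, Complex.ofReal_mul v, mul_left_comm, Complex.ofReal_exp,
      ← Complex.exp_add]
    congr 2
    push_cast
    ring
  · intro v hv
    rw [Set.mem_Ioi, not_lt] at hv
    rw [max_eq_right hv, zero_mul, Complex.ofReal_zero, smul_zero]

/-- The inverse Laplace transform of `ζ ^ (-2)` on the line `Re ζ = 1`. -/
lemma integral_inv_sq_mul_cexp (b : ℝ) :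
    ∫ y : ℝ, ((1 + y * Complex.I : ℂ) ^ 2)⁻¹ * Complex.exp (b * (1 + y * Complex.I)) =
      2 * Real.pi * (max b 0 : ℝ) := by
  have hcont : Continuous (fun v : ℝ => ((max v 0 * Real.exp (-v) : ℝ) : ℂ)) := by fun_prop
  have hF : FourierTransform.fourier (fun v : ℝ => ((max v 0 * Real.exp (-v) : ℝ) : ℂ)) =
      fun w : ℝ => ((1 + (2 * Real.pi * w : ℝ) * Complex.I) ^ 2)⁻¹ :=
    funext fourier_rampExp
  have hint : Integrable (fun w : ℝ => ((1 + (2 * Real.pi * w : ℝ) * Complex.I) ^ 2)⁻¹) :=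
    integrable_inv_one_add_mul_I_sq.comp_mul_left' (by positivity)
  -- Fourier inversion for the ramp max(v, 0) e^{-v}, whose transform is ζ⁻² on the line Re ζ = 1.
  have h := congrFun (hcont.fourierInv_fourier_eq integrable_rampExp (by rw [hF]; exact hint)) b
  rw [hF, Real.fourierInv_eq'] at h
  simp only [RCLike.inner_apply, conj_trivial, smul_eq_mul] at h
  have h2 := Measure.integral_comp_mul_left (fun y : ℝ => Complex.exp ((b * y : ℝ) * Complex.I) *
    ((1 + y * Complex.I : ℂ) ^ 2)⁻¹) (2 * Real.pi)
  have e : ∀ y : ℝ, ((1 + y * Complex.I : ℂ) ^ 2)⁻¹ * Complex.exp (b * (1 + y * Complex.I)) =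
      Complex.exp b * (Complex.exp ((b * y : ℝ) * Complex.I) *
        ((1 + y * Complex.I : ℂ) ^ 2)⁻¹) := by
    intro y
    rw [← mul_assoc, ← Complex.exp_add, mul_comm]
    congr 2
    push_cast
    ring
  simp_rw [e]
  rw [integral_const_mul]
  have h3 : ∫ y : ℝ, Complex.exp ((b * y : ℝ) * Complex.I) * ((1 + y * Complex.I : ℂ) ^ 2)⁻¹ =
      2 * Real.pi * ((max b 0 * Real.exp (-b) : ℝ) : ℂ) := by
    rw [← h]
    have h4 : (fun v : ℝ => Complex.exp (↑(2 * Real.pi * (b * v)) * Complex.I) *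
        ((1 + (2 * Real.pi * v : ℝ) * Complex.I) ^ 2)⁻¹) = fun v : ℝ =>
        Complex.exp ((b * (2 * Real.pi * v) : ℝ) * Complex.I) *
        ((1 + (2 * Real.pi * v : ℝ) * Complex.I : ℂ) ^ 2)⁻¹ := by
      funext v
      congr 4
      ring
    rw [h4, h2, abs_of_pos (by positivity), Complex.real_smul]
    generalize (∫ y : ℝ, Complex.exp ((b * y : ℝ) * Complex.I) *
      ((1 + y * Complex.I : ℂ) ^ 2)⁻¹) = J
    push_cast
    have : (Real.pi : ℂ) ≠ 0 := by exact_mod_cast Real.pi_ne_zero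
    field_simp
  rw [h3, Complex.ofReal_mul, Complex.ofReal_exp, Complex.ofReal_neg, Complex.exp_neg]
  have := Complex.exp_ne_zero b
  field_simp

/-- In the right half-plane the principal logarithm changes sign under inversion, so the principal
roots match without a branch correction. -/
lemma cpow_half_pi_div {ξ : ℝ} (hξ : 0 < ξ) {ζ : ℂ} (hζ : 0 < ζ.re) :
    (Real.pi / (ξ / ζ)) ^ (1 / 2 : ℂ) = ζ / √ξ * (Real.pi / ζ) ^ (1 / 2 : ℂ) := by
  have hζ0 : ζ ≠ 0 := by rintro rfl; simp at hζ
  have harg : ζ.arg ≠ Real.pi := fun h => by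
    rw [Complex.arg_eq_pi_iff] at h; linarith [h.1]
  have hξ0 : (ξ : ℂ) ≠ 0 := by exact_mod_cast hξ.ne'
  have hpi0 : (Real.pi : ℂ) ≠ 0 := by exact_mod_cast Real.pi_ne_zero
  have e1 : (Real.pi / (ξ / ζ) : ℂ) = ((Real.pi / ξ : ℝ) : ℂ) * ζ := by
    push_cast; field_simp
  have hsq : ((√ξ : ℝ) : ℂ) = Complex.exp (Real.log ξ / 2) := by
    rw [Real.sqrt_eq_rpow, Real.rpow_def_of_pos hξ]
    push_cast
    congr 1; ring
  rw [e1, div_eq_mul_inv (Real.pi : ℂ), Complex.cpow_def_of_ne_zero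
    (mul_ne_zero (by exact_mod_cast (by positivity : Real.pi / ξ ≠ 0)) hζ0),
    Complex.cpow_def_of_ne_zero (mul_ne_zero hpi0 (inv_ne_zero hζ0)),
    Complex.log_ofReal_mul (by positivity) hζ0,
    Complex.log_ofReal_mul Real.pi_pos (inv_ne_zero hζ0), Complex.log_inv _ harg,
    Real.log_div Real.pi_ne_zero hξ.ne', hsq]
  nth_rewrite 2 [← Complex.exp_log hζ0]
  rw [← Complex.exp_sub, ← Complex.exp_add]
  congr 1
  push_cast
  ring

/-- The τ-integral contributes a multiple of ζ^{1/2}, written as ζ · ζ^{-1/2}. The part ζ^{-1/2}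
exp(-d²/(4ξζ)) is a Fourier transform of exp(-ζv²), which leaves ζ⁻² and an exponent linear in ζ,
ready for Laplace inversion. -/
lemma integral_bulkLimit_right {ξ : ℝ} (hξ : 0 < ξ) (c d y : ℝ) :
    ∫ τ : ℝ, bulkLimit c ξ d (y, τ) = Complex.exp c / √ξ * ∫ v : ℝ,
      Complex.exp (Complex.I * (d / √ξ : ℝ) * v) * (((1 + y * Complex.I : ℂ) ^ 2)⁻¹ *
        Complex.exp ((1 - ξ / 4 - v ^ 2 : ℝ) * (1 + y * Complex.I))) := by
  set ζ : ℂ := 1 + y * Complex.I with hζdef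
  have hζ0 : ζ ≠ 0 := one_add_mul_I_ne_zero y
  have hζ : 0 < ζ.re := by simp [hζdef]
  have hξ0 : (ξ : ℂ) ≠ 0 := by exact_mod_cast hξ.ne'
  have hq0 : ((√ξ : ℝ) : ℂ) ≠ 0 := by exact_mod_cast (Real.sqrt_pos.2 hξ).ne'
  have hqq : ((√ξ : ℝ) : ℂ) ^ 2 = ξ := by
    rw [← Complex.ofReal_pow, Real.sq_sqrt hξ.le]
  have hre : 0 < (ξ / ζ : ℂ).re := by
    rw [div_eq_mul_inv, Complex.re_ofReal_mul, Complex.inv_re]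
    exact mul_pos hξ (div_pos hζ (Complex.normSq_pos.2 hζ0))
  have h1 : ∀ τ : ℝ, bulkLimit c ξ d (y, τ) = (ζ ^ 3)⁻¹ * Complex.exp (c + (1 - ξ / 4) * ζ
      - d ^ 2 / (4 * ξ) / ζ) * Complex.exp (-(ξ / ζ) * (τ : ℂ) ^ 2) := by
    intro τ
    rw [bulkLimit, mul_assoc, ← Complex.exp_add]
    congr 2
    dsimp only
    ring
  have h2 : ∀ v : ℝ, Complex.exp (Complex.I * (d / √ξ : ℝ) * v) * ((ζ ^ 2)⁻¹ *
      Complex.exp ((1 - ξ / 4 - v ^ 2 : ℝ) * ζ)) = (ζ ^ 2)⁻¹ * Complex.exp ((1 - ξ / 4) * ζ) *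
      (Complex.exp (Complex.I * (d / √ξ : ℝ) * v) * Complex.exp (-ζ * (v : ℂ) ^ 2)) := by
    intro v
    have : Complex.exp ((1 - ξ / 4 - v ^ 2 : ℝ) * ζ) = Complex.exp ((1 - ξ / 4) * ζ) *
        Complex.exp (-ζ * (v : ℂ) ^ 2) := by
      rw [← Complex.exp_add]; congr 1; push_cast; ring
    rw [this]
    ring
  simp_rw [h1, h2]
  rw [integral_const_mul, integral_const_mul, integral_gaussian_complex hre,
    fourierIntegral_gaussian hζ, cpow_half_pi_div hξ hζ]
  have h3 : Complex.exp (c + (1 - ξ / 4) * ζ - d ^ 2 / (4 * ξ) / ζ) = Complex.exp c *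
      Complex.exp ((1 - ξ / 4) * ζ) * Complex.exp (-((d / √ξ : ℝ) : ℂ) ^ 2 / (4 * ζ)) := by
    rw [← Complex.exp_add, ← Complex.exp_add]
    congr 1
    push_cast
    rw [div_pow, hqq]
    field_simp
    ring
  rw [h3]
  field_simp

lemma integrable_bulkLaplace (β κ : ℝ) : Integrable (fun p : ℝ × ℝ =>
    Complex.exp (Complex.I * κ * p.2) * (((1 + p.1 * Complex.I : ℂ) ^ 2)⁻¹ *
      Complex.exp ((β - p.2 ^ 2 : ℝ) * (1 + p.1 * Complex.I)))) := by
  have h : ∀ p : ℝ × ℝ, (1 + p.1 * Complex.I : ℂ) ^ 2 ≠ 0 := fun p =>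
    pow_ne_zero _ (one_add_mul_I_ne_zero p.1)
  have hg : Integrable (fun v : ℝ => Real.exp β * Real.exp (-1 * v ^ 2)) :=
    (integrable_exp_neg_mul_sq one_pos).const_mul _
  refine (integrable_inv_one_add_sq.mul_prod hg).mono' (by fun_prop (disch := assumption) :
    Continuous _).aestronglyMeasurable (Eventually.of_forall fun p => le_of_eq ?_)
  rw [norm_mul, norm_mul, norm_inv, norm_pow, norm_one_add_mul_I_sq, Complex.norm_exp,
    Complex.norm_exp, Complex.re_ofReal_mul, ← Real.exp_add]
  have e1 : (Complex.I * κ * p.2).re = 0 := by simp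
  rw [e1, Real.exp_zero, one_mul]
  congr 2
  simp
  ring

lemma integral_bulkLimit {ξ : ℝ} (hξ : 0 < ξ) (c d : ℝ) :
    ∫ p, bulkLimit c ξ d p = 2 * Real.pi * Complex.exp c / √ξ *
      ∫ v : ℝ, Complex.exp (Complex.I * (d / √ξ : ℝ) * v) * (max (1 - ξ / 4 - v ^ 2) 0 : ℝ) := by
  rw [Measure.volume_eq_prod, integral_prod _ (integrable_bulkLimit hξ c d)]
  simp_rw [integral_bulkLimit_right hξ]
  rw [integral_const_mul, integral_integral_swap (integrable_bulkLaplace (1 - ξ / 4) (d / √ξ))]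
  simp_rw [integral_const_mul, integral_inv_sq_mul_cexp]
  rw [← integral_const_mul, ← integral_const_mul]
  congr 1
  funext v
  ring

lemma integral_cexp_mul_parabola {k : ℝ} (hk : k ≠ 0) :
    ∫ r in (-1 : ℝ)..1, Complex.exp (Complex.I * k * r) * (1 - r ^ 2 : ℝ) =
      ((4 * Real.sin k / k ^ 3 - 4 * Real.cos k / k ^ 2 : ℝ) : ℂ) := by
  set a : ℂ := Complex.I * k with ha
  have hkc : (k : ℂ) ≠ 0 := by exact_mod_cast hk
  have ha0 : a ≠ 0 := mul_ne_zero Complex.I_ne_zero hkc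
  have hd : ∀ r : ℝ, HasDerivAt (fun r : ℝ => Complex.exp (a * r) *
      ((1 - (r : ℂ) ^ 2) / a + 2 * r / a ^ 2 - 2 / a ^ 3))
      (Complex.exp (a * r) * (1 - r ^ 2 : ℝ)) r := by
    intro r
    have h1 : HasDerivAt (fun r : ℝ => (r : ℂ)) 1 r := Complex.ofRealCLM.hasDerivAt
    have h2 := ((h1.const_mul a).cexp).mul (((((h1.pow 2).const_sub 1).div_const a).add
      ((h1.const_mul 2).div_const (a ^ 2))).sub_const (2 / a ^ 3))
    refine h2.congr_deriv ?_
    push_cast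
    simp only [Pi.add_apply, Pi.pow_apply]
    field_simp
    ring
  rw [intervalIntegral.integral_eq_sub_of_hasDerivAt (fun r _ => hd r)
    (Continuous.intervalIntegrable (by fun_prop) _ _)]
  have e1 : Complex.exp (a * (1 : ℝ)) = Complex.cos k + Complex.sin k * Complex.I := by
    rw [← Complex.exp_mul_I, ha]; congr 1; push_cast; ring
  have e2 : Complex.exp (a * (-1 : ℝ)) = Complex.cos k - Complex.sin k * Complex.I := by
    have := Complex.exp_mul_I (-k : ℂ)
    rw [Complex.cos_neg, Complex.sin_neg, neg_mul (Complex.sin _), ← sub_eq_add_neg] at this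
    rw [← this, ha]; congr 1; push_cast; ring
  rw [e1, e2, ha]
  push_cast
  have hI := Complex.I_sq
  have hI3 : Complex.I ^ 3 = -Complex.I := by rw [pow_succ, hI]; ring
  rw [mul_pow, mul_pow, hI, hI3]
  field_simp
  ring_nf

/-- The kernel is the Fourier transform of a truncated parabola; at frequency 0 the area 4/3 gives
the diagonal value. -/
lemma integral_parabola_eq_diffSineKernel (μ ν : ℝ) :
    (Real.pi : ℂ) ^ 2 / 2 * ∫ r in (-1 : ℝ)..1,
      Complex.exp (Complex.I * (Real.pi * (μ - ν) : ℝ) * r) * (1 - r ^ 2 : ℝ) =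
      (diffSineKernel μ ν : ℂ) := by
  unfold diffSineKernel
  split_ifs with h
  · subst h
    simp only [sub_self, mul_zero, Complex.ofReal_zero, zero_mul, Complex.exp_zero, one_mul]
    rw [intervalIntegral.integral_ofReal]
    have : ∫ r in (-1 : ℝ)..1, (1 - r ^ 2) = 4 / 3 := by
      rw [intervalIntegral.integral_sub (by simp) (Continuous.intervalIntegrable (by fun_prop) _ _)]
      simp only [intervalIntegral.integral_const, integral_pow]
      norm_num
    rw [this]
    push_cast
    ring
  · have hd : μ - ν ≠ 0 := sub_ne_zero.2 h
    rw [integral_cexp_mul_parabola (mul_ne_zero Real.pi_ne_zero hd)]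
    rw [← Complex.ofReal_pow, ← Complex.ofReal_ofNat, ← Complex.ofReal_div, ← Complex.ofReal_mul]
    congr 1
    have := Real.pi_ne_zero
    field_simp
    ring

lemma integral_cexp_mul_max {β : ℝ} (hβ : 0 < β) (κ : ℝ) :
    ∫ v : ℝ, Complex.exp (Complex.I * κ * v) * (max (β - v ^ 2) 0 : ℝ) =
      √β ^ 3 * ∫ r in (-1 : ℝ)..1,
        Complex.exp (Complex.I * (κ * √β : ℝ) * r) * (1 - r ^ 2 : ℝ) := by
  have hq : 0 < √β := Real.sqrt_pos.2 hβ
  have hqq : √β ^ 2 = β := Real.sq_sqrt hβ.le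
  have h1 := Measure.integral_comp_mul_left (fun v : ℝ =>
    Complex.exp (Complex.I * κ * v) * (max (β - v ^ 2) 0 : ℝ)) √β
  rw [abs_of_pos (inv_pos.2 hq), Complex.real_smul] at h1
  have h2 : ∫ r in (-1 : ℝ)..1, Complex.exp (Complex.I * (κ * √β : ℝ) * r) * (1 - r ^ 2 : ℝ) =
      ∫ r : ℝ, Complex.exp (Complex.I * (κ * √β : ℝ) * r) * (max (1 - r ^ 2) 0 : ℝ) := by
    rw [intervalIntegral.integral_of_le (by norm_num),
      ← setIntegral_eq_integral_of_forall_compl_eq_zero (s := Set.Ioc (-1 : ℝ) 1)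
        (f := fun r : ℝ => Complex.exp (Complex.I * (κ * √β : ℝ) * r) * (max (1 - r ^ 2) 0 : ℝ))]
    · refine setIntegral_congr_fun measurableSet_Ioc fun r hr => ?_
      have : 0 ≤ 1 - r ^ 2 := by nlinarith [hr.1, hr.2]
      rw [max_eq_left this]
    · intro r hr
      have : 1 - r ^ 2 ≤ 0 := by
        by_contra! h
        exact hr ⟨by nlinarith, by nlinarith⟩
      rw [max_eq_right this, Complex.ofReal_zero, mul_zero]
  have h3 : ∀ r : ℝ, Complex.exp (Complex.I * κ * (√β * r : ℝ)) *
      (max (β - (√β * r) ^ 2) 0 : ℝ) = (β : ℂ) *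
      (Complex.exp (Complex.I * (κ * √β : ℝ) * r) * (max (1 - r ^ 2) 0 : ℝ)) := by
    intro r
    have : max (β - (√β * r) ^ 2) 0 = β * max (1 - r ^ 2) 0 := by
      rw [mul_max_of_nonneg _ _ hβ.le, mul_zero, mul_pow, hqq]
      congr 1; ring
    rw [this]
    push_cast
    rw [mul_left_comm]
    congr 3
    ring
  simp_rw [h3] at h1
  rw [integral_const_mul] at h1
  rw [h2]
  have hq0 : ((√β : ℝ) : ℂ) ≠ 0 := by exact_mod_cast hq.ne'
  have hqqc : ((√β : ℝ) : ℂ) ^ 2 = β := by rw [← Complex.ofReal_pow, hqq]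
  rw [pow_succ', hqqc, mul_assoc, h1, Complex.ofReal_inv, mul_inv_cancel_left₀ hq0]

lemma mpDensity_eq {ξ : ℝ} (hξ : 0 < ξ) : mpDensity ξ = √(1 - ξ / 4) / (Real.pi * √ξ) := by
  have h4 : √(ξ * (4 - ξ)) = √ξ * (2 * √(1 - ξ / 4)) := by
    rw [Real.sqrt_mul hξ.le, show 4 - ξ = 2 ^ 2 * (1 - ξ / 4) by ring,
      Real.sqrt_mul (by norm_num) (1 - ξ / 4), Real.sqrt_sq (by norm_num)]
  have hq : 0 < √ξ := Real.sqrt_pos.2 hξ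
  have hqq : √ξ ^ 2 = ξ := Real.sq_sqrt hξ.le
  rw [mpDensity, h4]
  have hpi := Real.pi_ne_zero
  set r := √(1 - ξ / 4)
  field_simp
  linear_combination r * hqq

lemma integral_bulkLimit_eq_diffSineKernel {ξ : ℝ} (hξ : ξ ∈ Set.Ioo (0 : ℝ) 4) (c μ ν : ℝ) :
    (ξ : ℂ)⁻¹ * ((mpDensity ξ : ℂ) ^ 3)⁻¹ * (((2 * Real.pi : ℂ) ^ 2)⁻¹ *
      ∫ p, bulkLimit c ξ (μ / mpDensity ξ - ν / mpDensity ξ) p) =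
      ((Real.exp c * diffSineKernel μ ν : ℝ) : ℂ) := by
  obtain ⟨h0, h4⟩ := hξ
  have hβ : 0 < 1 - ξ / 4 := by linarith
  have hb : 0 < √(1 - ξ / 4) := Real.sqrt_pos.2 hβ
  have hq : 0 < √ξ := Real.sqrt_pos.2 h0
  have hqq : ((√ξ : ℝ) : ℂ) ^ 2 = ξ := by
    rw [← Complex.ofReal_pow, Real.sq_sqrt h0.le]
  -- Since √(1 - ξ/4) = π g √ξ, rescaling by the density makes the frequency π(μ - ν). The cube of
  -- the same identity absorbs ξ⁻¹ g⁻³.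
  have hk : (μ / mpDensity ξ - ν / mpDensity ξ) / √ξ * √(1 - ξ / 4) = Real.pi * (μ - ν) := by
    rw [mpDensity_eq h0]
    field_simp
  rw [integral_bulkLimit h0, integral_cexp_mul_max hβ, hk,
    Complex.ofReal_mul (Real.exp c), ← integral_parabola_eq_diffSineKernel, mpDensity_eq h0,
    Complex.ofReal_exp]
  have hpi0 : (Real.pi : ℂ) ≠ 0 := by exact_mod_cast Real.pi_ne_zero
  have hq0 : ((√ξ : ℝ) : ℂ) ≠ 0 := by exact_mod_cast hq.ne'
  have hb0 : ((√(1 - ξ / 4) : ℝ) : ℂ) ≠ 0 := by exact_mod_cast hb.ne'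
  rw [← hqq]
  generalize (∫ r in (-1 : ℝ)..1, Complex.exp (Complex.I * (Real.pi * (μ - ν) : ℝ) * r) *
    (1 - r ^ 2 : ℝ)) = J
  set r := √(1 - ξ / 4)
  push_cast
  field_simp

end BulkIntegral

/-! ### Assembling the rescaled correlation function -/

section RescaledCorrelation

variable {Q : Measure ℝ} [IsProbabilityMeasure Q] {b : ℝ}

lemma bulkScaling_eq (α N : ℕ) {ξ μ ν : ℝ} (hs : 0 < N * ξ + μ) (ht : 0 < N * ξ + ν) :
    bulkScaling α N ξ μ ν = √((N * ξ + μ) * (N * ξ + ν)) ^ α *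
      Real.exp (-(((N * ξ + μ) + (N * ξ + ν)) / 2)) := by
  rw [bulkScaling]
  congr 1
  · rw [Real.sqrt_eq_rpow, ← Real.rpow_mul_natCast (mul_pos hs ht).le]
    congr 1 <;> ring
  · congr 1; ring

/-- The rescaled second-order correlation function as an integral over a growing square. -/
lemma rescaled_secondCorrelation (hQ : HasStandingMoments Q b) {α N : ℕ} (hN : 0 < N)
    (hα : α ≤ N) {Ω : Type*} [MeasurableSpace Ω] {P : Measure Ω} [IsProbabilityMeasure P]
    {X : Ω → Matrix (Fin N) (Fin (N - α)) ℝ} (hX : IsIIDMatrix X Q P) {ξ g μ ν : ℝ}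
    (hs : 0 < N * ξ + μ) (ht : 0 < N * ξ + ν) :
    (((N : ℝ)⁻¹ * ξ⁻¹ * (g ^ 3)⁻¹ * bulkScaling α N ξ μ ν *
      (secondCorrelation X P (N * ξ + μ) (N * ξ + ν) / ((N ! : ℝ) * ((N - α)! : ℝ))) : ℝ) : ℂ) =
    (ξ : ℂ)⁻¹ * ((g : ℂ) ^ 3)⁻¹ * (((2 * Real.pi : ℂ) ^ 2)⁻¹ * ∫ p in scaledSquare N,
      bulkIntegrand (b - 3) α (N - α) N (N * ξ + μ) (N * ξ + ν) p) := by
  have hN' : (0 : ℝ) < N := by exact_mod_cast hN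
  have h1 := torusCoeff_bulk (c := b - 3) hN' hs ht α (N - α)
  rw [Nat.sub_add_cancel hα] at h1
  have h2 := gramCorr_eq_torusCoeff hQ (torusRadii_bulk hN' hs ht) N (N - α)
    (N * ξ + μ) (N * ξ + ν)
  have hf1 : (N ! : ℂ) ≠ 0 := by exact_mod_cast N.factorial_ne_zero
  have hf2 : ((N - α)! : ℂ) ≠ 0 := by exact_mod_cast (N - α).factorial_ne_zero
  rw [← h1, hX.secondCorrelation_eq, bulkScaling_eq α N hs ht]
  simp only [Complex.ofReal_mul, Complex.ofReal_div, Complex.ofReal_inv, Complex.ofReal_pow,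
    Complex.ofReal_natCast, Complex.ofReal_exp, Complex.ofReal_neg, h2]
  rw [mul_assoc (N ! : ℂ), mul_div_mul_left _ _ hf1, mul_div_cancel_left₀ _ hf2]
  push_cast
  ring

end RescaledCorrelation

theorem theorem4p2
    (Q : Measure ℝ) [IsProbabilityMeasure Q] (b : ℝ) (hQ : HasStandingMoments Q b)
    (α : ℕ)
    {Ω : ℕ → Type*} [∀ N, MeasurableSpace (Ω N)]
    (P : ∀ N, Measure (Ω N)) [∀ N, IsProbabilityMeasure (P N)]
    (X : ∀ N, Ω N → Matrix (Fin N) (Fin (N - α)) ℝ)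
    (hX : ∀ N, IsIIDMatrix (X N) Q (P N))
    (ξ : ℝ) (hξ : ξ ∈ Set.Ioo (0 : ℝ) 4) (μ ν : ℝ) :
    (∀ N s t, Integrable (fun ω => charPolyProduct (X N ω) s t) (P N)) ∧
    Tendsto
      (fun N : ℕ =>
        (N : ℝ)⁻¹ * ξ⁻¹ * (mpDensity ξ ^ 3)⁻¹
          * bulkScaling α N ξ (μ / mpDensity ξ) (ν / mpDensity ξ)
          * (secondCorrelation (X N) (P N)
              (N * ξ + μ / mpDensity ξ) (N * ξ + ν / mpDensity ξ)
            / ((N ! : ℝ) * ((N - α)! : ℝ))))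
      atTop (𝓝 (Real.exp (b - 3) * diffSineKernel μ ν)) := by
  refine ⟨fun N s t => (hX N).integrable_charPolyProduct hQ s t, ?_⟩
  have h := (tendsto_integral_bulkIntegrand hξ.1 (b - 3) (μ / mpDensity ξ) (ν / mpDensity ξ)
    α).const_mul ((2 * Real.pi : ℂ) ^ 2)⁻¹ |>.const_mul ((ξ : ℂ)⁻¹ * ((mpDensity ξ : ℂ) ^ 3)⁻¹)
  rw [integral_bulkLimit_eq_diffSineKernel hξ] at h
  refine (Complex.continuous_re.continuousAt.tendsto.comp h).congr' ?_
  -- The integral formula needs N ≥ α, so that N - α is a true difference, and both spectral points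
  -- positive, so that √(st) is a valid radius scale; all hold for large N.
  filter_upwards [eventually_gt_atTop 0, eventually_ge_atTop α,
    eventually_affine_pos hξ.1 (μ / mpDensity ξ), eventually_affine_pos hξ.1 (ν / mpDensity ξ)]
    with N hN hα hs ht
  rw [Function.comp_apply, ← Complex.ofReal_re (_ * _ * _ * _ * _)]
  congr 1
  exact (rescaled_secondCorrelation hQ hN hα (hX N) hs ht).symm
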